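/- Let $p$ be a prime number and let $G$ be a profinite group that is a semidirect product $G=H\rtimes\Gamma$ with $H$ a normal subgroup, where $H$ and $\Gamma$ are subgroups isomorphic, as topological groups, to the additive group $\mathbb{Z}_p$. For a profinite group $U$ let $\Lambda(U)=\mathbb{Z}_p[\![U]\!]=\varprojlim_N\mathbb{Z}_p[U/N]$ ($N$ running over the open normal subgroups of $U$) be its Iwasawa algebra and $I_U$ the kernel of the augmentation $\Lambda(U)\to\mathbb{Z}_p$. Put $H_n=H^{p^n}$ and $\Gamma_n=\Gamma^{p^n}$ for $n\ge 0$. For a left $\Lambda(G)$-module $X$ let $X_{H_n}=X/I_{H_n}X$, a $\Lambda(\Gamma)$-module, and $(X_{H_n})_{\Gamma_n}=X_{H_n}/I_{\Gamma_n}X_{H_n}$, and let $X'_{H_n}$ be the maximal finite $\Lambda(\Gamma)$-submodule of $X_{H_n}$. A finitely generated left $\Lambda(G)$-module $M$ is called pseudo-null if $\mathrm{Ext}^i_{\Lambda(G)}(M,\Lambda(G))=0$ for $i=0,1$. Then one can attach to left $\Lambda(G)$-modules $M$ integers $\mu_M,\nu_M\ge 0$ and $\nu'_M\geq 0$, depending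 only on $M$ (and on $p,G,H,\Gamma$), such that the following holds. Let $X$ be a finitely generated $\Lambda(G)$-module each element of which is killed by a power of $p$, and let $$0\to A\to X\xrightarrow{\varphi}\bigoplus_{i=1}^s\Lambda(G)/p^{m_i}\Lambda(G)\to B\to 0$$ be an exact sequence of $\Lambda(G)$-modules, where $s\ge 0$, $m_i\ge 0$ and $A$, $B$ are pseudo-null $\Lambda(G)$-modules that are finitely generated over $\Lambda(H)$. Put $\mu_G=\sum_{i=1}^s m_i$ and write $\nu_B$ for $\nu'_B$. Then: 1. $\mu_G$ is the Iwasawa $\mu_G$-invariant of $X$, in the sense that there is a $\Lambda(G)$-homomorphism with pseudo-null kernel and cokernel from the $\mathbb{Z}_p$-torsion submodule $X(p)$ of $X$ to a module $\bigoplus_{j=1}^t\Lambda(G)/p^{l_j}\Lambda(G)$ with $\sum_{j=1}^t l_j=\mu_G$; 2. $\#X'_{H_k}=p^{\mu_Ap^k+\nu_A+\nu_B}$ for all sufficiently large $k$ (so these are the constants of the asymptotic formula for the maximal finite submodules); 3. for all $n\ge 0$, $$p^{\mu_Gp^{2n}}\le\#(X_{H_n})_{\Gamma_n}\le p^{\mu_Gp^{2n}+\mu_Ap^n+\nu_A+\nu_B}.$$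 -/

import Mathlib

open CategoryTheory

universe u

noncomputable section

/-! ### The Iwasawa algebra of a profinite group -/

section IwasawaAlgebra

variable (p : ℕ) [Fact p.Prime] (G : Type u) [Group G] [TopologicalSpace G]

/-- The transition map `ℤ_p[G/N] → ℤ_p[G/M]` for open normal subgroups `N ≤ M`. -/
def iwasawaTransition {G : Type u} [Group G] [TopologicalSpace G]
    {N M : OpenNormalSubgroup G} (h : N ≤ M) :
    MonoidAlgebra ℤ_[p] (G ⧸ N.toSubgroup) →+* MonoidAlgebra ℤ_[p] (G ⧸ M.toSubgroup) :=
  MonoidAlgebra.mapDomainRingHom ℤ_[p]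
    (QuotientGroup.map N.toSubgroup M.toSubgroup (MonoidHom.id G) h)

/-- The inverse limit of the group rings `ℤ_p[G/N]` over the open normal subgroups `N` of `G`,
as a subring of their product. -/
def iwasawaSubring :
    Subring (∀ N : OpenNormalSubgroup G, MonoidAlgebra ℤ_[p] (G ⧸ N.toSubgroup)) where
  carrier := {x | ∀ (N M : OpenNormalSubgroup G) (h : N ≤ M),
    iwasawaTransition p h (x N) = x M}
  mul_mem' {x y} hx hy N M h := by
    rw [Pi.mul_apply, map_mul, hx N M h, hy N M h, Pi.mul_apply]
  one_mem' N M h := by rw [Pi.one_apply, map_one, Pi.one_apply]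
  add_mem' {x y} hx hy N M h := by
    rw [Pi.add_apply, map_add, hx N M h, hy N M h, Pi.add_apply]
  zero_mem' N M h := by rw [Pi.zero_apply, map_zero, Pi.zero_apply]
  neg_mem' {x} hx N M h := by rw [Pi.neg_apply, map_neg, hx N M h, Pi.neg_apply]

/-- The Iwasawa algebra (completed group ring) `Λ(G) = ℤ_p⟦G⟧ = lim ℤ_p[G/N]`. -/
abbrev IwasawaAlgebra : Type u := iwasawaSubring p G

/-- The group `G` as an open normal subgroup of itself. -/
def wholeGroup : OpenNormalSubgroup G :=
  { (⊤ : OpenSubgroup G) with isNormal' := (inferInstance : (⊤ : Subgroup G).Normal) }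

/-- The augmentation `Λ(G) → ℤ_p`: project to `ℤ_p[G/G]` and sum the coefficients. -/
def iwasawaAugmentation : IwasawaAlgebra p G →+* ℤ_[p] :=
  ((MonoidAlgebra.lift ℤ_[p] ℤ_[p] (G ⧸ (wholeGroup G).toSubgroup) 1).toRingHom.comp
    (Pi.evalRingHom _ (wholeGroup G))).comp (iwasawaSubring p G).subtype

variable {G}

/-- The trace on a subgroup `U` of an open normal subgroup of `G`. -/
def OpenNormalSubgroup.restrict (U : Subgroup G) (N : OpenNormalSubgroup G) :
    OpenNormalSubgroup U :=
  { N.toOpenSubgroup.comap U.subtype continuous_subtype_val with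
    isNormal' := N.isNormal'.comap U.subtype }

/-- The natural ring homomorphism `Λ(U) → Λ(G)` for a subgroup `U` of `G` (with the subspace
topology). Its component at `M` is `ℤ_p[U/(U ∩ M)] → ℤ_p[G/M]`. -/
def iwasawaInclusion (U : Subgroup G) : IwasawaAlgebra p U →+* IwasawaAlgebra p G where
  toFun x := ⟨fun M => MonoidAlgebra.mapDomainRingHom ℤ_[p]
      (QuotientGroup.map (M.restrict U).toSubgroup M.toSubgroup U.subtype (fun _ hx => hx))
      (x.1 (M.restrict U)), by
    intro N M h
    have h' : N.restrict U ≤ M.restrict U := fun _ hx => h hx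
    beta_reduce
    rw [← x.2 _ _ h', iwasawaTransition, iwasawaTransition, ← RingHom.comp_apply,
      ← RingHom.comp_apply, ← MonoidAlgebra.mapDomainRingHom_comp,
      ← MonoidAlgebra.mapDomainRingHom_comp]
    congr 2
    ext g
    rfl⟩
  map_zero' := Subtype.ext <| funext fun _ => map_zero _
  map_one' := Subtype.ext <| funext fun _ => map_one _
  map_add' _ _ := Subtype.ext <| funext fun _ => map_add _ _ _
  map_mul' _ _ := Subtype.ext <| funext fun _ => map_mul _ _ _

end IwasawaAlgebra

/-! ### Coinvariants -/

section Coinvariants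

variable (p : ℕ) [Fact p.Prime] {G : Type u} [Group G] [TopologicalSpace G]

/-- `U^k`, the subgroup generated by the `k`-th powers of the elements of `U` (for commutative `U`
it consists of the `k`-th powers). -/
def powSubgroup (U : Subgroup G) (k : ℕ) : Subgroup G :=
  Subgroup.closure ((fun g => g ^ k) '' (U : Set G))

/-- `I_U X`, where `I_U` is the kernel of the augmentation `Λ(U) → ℤ_p`. It is used for normal
subgroups `U` only; then `I_U Λ(G) = Λ(G) I_U`, so that `I_U X` is a `Λ(G)`-submodule. -/
def augmentationSubmodule (U : Subgroup G) (X : Type u) [AddCommGroup X]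
    [Module (IwasawaAlgebra p G) X] : Submodule (IwasawaAlgebra p G) X :=
  Submodule.span (IwasawaAlgebra p G)
    {y | ∃ a ∈ RingHom.ker (iwasawaAugmentation p U), ∃ x : X, y = iwasawaInclusion p U a • x}

/-- The coinvariants `X_U = X / I_U X` of a `Λ(G)`-module `X` for a normal subgroup `U` of `G`. -/
abbrev Coinvariants (U : Subgroup G) (X : Type u) [AddCommGroup X]
    [Module (IwasawaAlgebra p G) X] : Type u :=
  X ⧸ augmentationSubmodule p U X

/-- A `Λ(G)`-module seen as a `Λ(U)`-module, for a subgroup `U` of `G`. -/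
abbrev restrictModule (U : Subgroup G) (X : Type u) [AddCommGroup X]
    [Module (IwasawaAlgebra p G) X] : Module (IwasawaAlgebra p U) X :=
  Module.compHom X (iwasawaInclusion p U)

/-- The `Λ(G)`-module `X` is finitely generated over `Λ(U)`. -/
def IsFinitelyGeneratedOver (U : Subgroup G) (X : Type u) [AddCommGroup X]
    [Module (IwasawaAlgebra p G) X] : Prop :=
  letI := restrictModule p U X
  Module.Finite (IwasawaAlgebra p U) X

/-- The double coinvariants `(X_{H_n})_{Γ_n}`, where `H_n = H^(p^n)` and `Γ_n = Γ^(p^n)`: the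
`Γ_n`-coinvariants of the `Λ(Γ)`-module `X_{H_n}`. -/
def DoubleCoinvariants (H Γ : Subgroup G) (n : ℕ) (X : Type u) [AddCommGroup X]
    [Module (IwasawaAlgebra p G) X] : Type u :=
  letI := restrictModule p Γ (Coinvariants p (powSubgroup H (p ^ n)) X)
  Coinvariants p (G := Γ) (powSubgroup (⊤ : Subgroup Γ) (p ^ n))
    (Coinvariants p (powSubgroup H (p ^ n)) X)

/-- The sum of all finite submodules of `M`; if it is finite, it is the maximal finite
submodule. -/
def maximalFiniteSubmodule (R M : Type u) [Ring R] [AddCommGroup M] [Module R M] :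
    Submodule R M :=
  sSup {N | Finite N}

/-- `X'_{H_m}`, the maximal finite `Λ(Γ)`-submodule of `X_{H_m}`, where `H_m = H^(p^m)`. -/
def FinitePartOfCoinvariants (H Γ : Subgroup G) (m : ℕ) (X : Type u) [AddCommGroup X]
    [Module (IwasawaAlgebra p G) X] : Type u :=
  letI := restrictModule p Γ (Coinvariants p (powSubgroup H (p ^ m)) X)
  maximalFiniteSubmodule (IwasawaAlgebra p Γ) (Coinvariants p (powSubgroup H (p ^ m)) X)

end Coinvariants

/-! ### Pseudo-null modules and the `μ_G`-invariant -/

section PseudoNull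

/-- A (finitely generated) left module `M` over `Λ` is pseudo-null if `Ext^i(M, Λ) = 0` for
`i = 0, 1`. -/
def IsPseudoNull (Λ : Type u) [Ring Λ] (M : Type u) [AddCommGroup M] [Module Λ M] : Prop :=
  ∀ i < 2, Subsingleton (Abelian.Ext (ModuleCat.of Λ M) (ModuleCat.of Λ Λ) i)

variable (p : ℕ) [Fact p.Prime] (G : Type u) [Group G] [TopologicalSpace G]

/-- The elementary module `⨁ i, Λ(G) / p^(m i) Λ(G)`, a finite direct sum, i.e. the product. -/
abbrev ElementaryModule {s : ℕ} (m : Fin s → ℕ) : Type u :=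
  ∀ i : Fin s, (IwasawaAlgebra p G ⧸
    (Submodule.span (IwasawaAlgebra p G) {(p : IwasawaAlgebra p G) ^ m i}))

/-- `X(p)`, the `ℤ_p`-torsion submodule of `X`, i.e. the elements killed by a power of `p`. -/
def pTorsion (X : Type u) [AddCommGroup X] [Module (IwasawaAlgebra p G) X] :
    Submodule (IwasawaAlgebra p G) X where
  carrier := {x | ∃ k : ℕ, p ^ k • x = 0}
  zero_mem' := ⟨0, smul_zero _⟩
  add_mem' := by
    rintro x y ⟨k, hk⟩ ⟨l, hl⟩
    refine ⟨k + l, ?_⟩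
    rw [smul_add, pow_add, mul_smul, mul_smul, hl, smul_comm, hk, smul_zero, smul_zero, add_zero]
  smul_mem' := by
    rintro a x ⟨k, hk⟩
    exact ⟨k, by rw [smul_comm, hk, smul_zero]⟩

/-- `μ` is the Iwasawa `μ_G`-invariant of `X`: there is a pseudo-isomorphism from `X(p)` to
`⨁ i, Λ(G) / p^(m i) Λ(G)` with `μ = ∑ i, m i`. -/
def IsMuInvariant (X : Type u) [AddCommGroup X] [Module (IwasawaAlgebra p G) X] (μ : ℕ) : Prop :=
  ∃ (s : ℕ) (m : Fin s → ℕ)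
    (φ : pTorsion p G X →ₗ[IwasawaAlgebra p G] ElementaryModule p G m),
    IsPseudoNull (IwasawaAlgebra p G) (LinearMap.ker φ) ∧
    IsPseudoNull (IwasawaAlgebra p G) (ElementaryModule p G m ⧸ LinearMap.range φ) ∧
    μ = ∑ i, m i

end PseudoNull

end

/-! Let `h` and `γ` be the topological generators of `H` and `Γ` that correspond to `1` in `ℤ_p`.
Because conjugates of `h ^ (p ^ n)` lie in the closure of its powers, `I_{H_n} X` is `(h ^ (p ^ n) -
1) X`, and likewise for `Γ_n` on a `Λ(Γ)`-module. Everything thus becomes a count of kernels and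
cokernels of the two operators `h ^ (p ^ n) - 1` and `γ ^ (p ^ n) - 1`. Write `E` for the elementary
module.

Three inputs are needed. (a) On `A` and `B`, which are finitely generated over `Λ(H)` and `p`-power
torsion, put `T = h - 1`. On a module killed by `p`, `T` has finite kernel and cokernel with
quotient of orders `p ^ μ`, and `h ^ (p ^ n) - 1` acts as `T ^ (p ^ n)`, which gives `p ^ (μ p ^
n)`. This Herbrand quotient is multiplicative in exact sequences, so filtering by powers of `p`
gives `#A_{H_n} = p ^ (μ_A p ^ n) #A^{H_n}`. The invariants increase with `n` and stabilise by
Noetherianity; `p ^ ν` is their final order, hence also an upper bound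
(`IsParameterMod.exists_card_asymptotics`). (b) On `E` the operator `h ^ (p ^ n) - 1` is injective,
and on `E_{H_n}` so is `γ ^ j - 1` for every `j ≠ 0`: a function on a finite quotient that is
invariant modulo `p` under an element of large `p`-power order sums to `0` modulo `p` along the
fibres of a coarser quotient. (c) `(E_{H_n})_{Γ_n}` is a product of copies of `ℤ/p ^ (m i)` indexed
by the `p ^ (2n)` orbits of `H_n` and `Γ_n` on `G`, so it has order `p ^ (μ_G p ^ (2n))`
(`index_elementaryModule`).

By injectivity on `E`, the kernel `K` of `X_{H_n} → E_{H_n}` has order `#A_{H_n} · #B^{H_n}`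
(`card_ker_coinvariantsMap`). Some positive power of `γ` fixes any given element of a finite
submodule, while `E_{H_n}` has no nonzero element fixed by such a power, so `K` is the maximal
finite submodule; this is part 2. For part 3, take cokernels of `γ ^ (p ^ n) - 1` along `X_{H_n} →
E_{H_n} → B_{H_n} → 0`: as `B_{H_n}` is finite and the operator is injective on `E_{H_n}`, the
orders for `X` and `E` differ exactly by the order of the cokernel on `K`, which lies between `1`
and `#K`. Part 1 reads off the given sequence, since `X(p) = X`. -/

noncomputable section

/-! ### Kernel and cokernel orders of endomorphisms; the Herbrand quotient -/

section Counting

variable {M M' M'' : Type*} [AddCommGroup M] [AddCommGroup M'] [AddCommGroup M'']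

/-- The cardinalities in the kernel-cokernel sequence of a short exact sequence with an
endomorphism, infinite cardinalities being counted as `0`. -/
theorem exists_snake_card {f' : M' →+ M'} {f : M →+ M} {f'' : M'' →+ M''} {i : M' →+ M} {q : M →+ M''}
    (hi : Function.Injective i) (hq : Function.Surjective q) (hiq : i.range = q.ker)
    (hfi : ∀ x, f (i x) = i (f' x)) (hfq : ∀ x, f'' (q x) = q (f x)) :
    ∃ a b c : ℕ, Nat.card f''.ker = a * b ∧ f'.range.index = b * c ∧
      f.range.index = c * f''.range.index ∧ Nat.card f.ker = Nat.card f'.ker * a := by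
  have hmap : f'.range.map i = i.range.map f := by
    rw [AddMonoidHom.map_range, AddMonoidHom.map_range]
    congr 1; ext x; simp [hfi]
  have hle : i.range.map f ≤ i.range := by
    rw [← hmap]; exact AddSubgroup.map_le_range _ _
  -- These are the orders of three images in the snake sequence: of `ker f` in `ker f''`, of the
  -- connecting map, and of `coker f'` in `coker f`.
  refine ⟨i.range.relIndex f.ker, (i.range ⊔ f.ker).relIndex (i.range.comap f),
    f.range.relIndex i.range, ?_, ?_, ?_, ?_⟩
  · have h1 : Nat.card f''.ker = i.range.relIndex (i.range.comap f) := by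
      rw [hiq, AddSubgroup.relIndex_ker]
      congr 2
      ext y
      obtain ⟨x, rfl⟩ := hq y
      simp only [AddMonoidHom.mem_ker, AddSubgroup.mem_map, AddSubgroup.mem_comap, hfq]
      constructor
      · exact fun h => ⟨x, h, rfl⟩
      · rintro ⟨z, hz, hzx⟩; rw [← hfq, ← hzx, hfq, hz]
    rw [h1, ← AddSubgroup.relIndex_mul_relIndex i.range (i.range ⊔ f.ker) (i.range.comap f) le_sup_left,
      AddSubgroup.relIndex_sup_left]
    refine sup_le (AddSubgroup.map_le_iff_le_comap.mp hle) fun x hx => ?_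
    rw [AddSubgroup.mem_comap, AddMonoidHom.mem_ker.mp hx]; exact zero_mem _
  · have h1 : f'.range.index = (i.range.map f).relIndex i.range := by
      rw [← hmap, ← AddSubgroup.relIndex_top_right,
        ← AddSubgroup.relIndex_map_map_of_injective f'.range ⊤ hi, ← AddMonoidHom.range_eq_map i]
    have h2 : f.range ⊓ i.range = (i.range.comap f).map f := by
      rw [AddSubgroup.map_comap_eq]
    have h3 : i.range.map f ≤ f.range ⊓ i.range := le_inf (AddSubgroup.map_le_range _ _) hle
    rw [h1, ← AddSubgroup.relIndex_mul_relIndex _ _ _ h3 inf_le_right, AddSubgroup.inf_relIndex_right,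
      h2, ← AddSubgroup.relIndex_comap, AddSubgroup.comap_map_eq]
  · have h0 : f''.range = f.range.map q := by
      ext y
      simp only [AddSubgroup.mem_map, AddMonoidHom.mem_range]
      constructor
      · rintro ⟨z, rfl⟩
        obtain ⟨x, rfl⟩ := hq z
        exact ⟨_, ⟨x, rfl⟩, (hfq x).symm⟩
      · rintro ⟨_, ⟨x, rfl⟩, rfl⟩
        exact ⟨q x, hfq x⟩
    have h1 : f''.range.index = (f.range ⊔ i.range).index := by
      rw [← AddSubgroup.index_comap_of_surjective _ hq, hiq, ← AddSubgroup.comap_map_eq, h0]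
    rw [h1, ← AddSubgroup.relIndex_mul_index (H := f.range) (K := f.range ⊔ i.range) le_sup_left,
      AddSubgroup.relIndex_sup_left]
  · have h1 : Nat.card f'.ker = Nat.card (i.range ⊓ f.ker : AddSubgroup M) := by
      rw [← AddSubgroup.card_map_of_injective (f := i) hi]
      congr 2
      ext y
      simp only [AddSubgroup.mem_map, AddMonoidHom.mem_ker, AddSubgroup.mem_inf, AddMonoidHom.mem_range]
      constructor
      · rintro ⟨x, hx, rfl⟩; exact ⟨⟨x, rfl⟩, by rw [hfi, hx, map_zero]⟩
      · rintro ⟨⟨x, rfl⟩, hx⟩; exact ⟨x, hi (by rw [← hfi, hx, map_zero]), rfl⟩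
    rw [h1, ← AddSubgroup.inf_relIndex_right, ← AddSubgroup.relIndex_bot_left, ← AddSubgroup.relIndex_bot_left,
      AddSubgroup.relIndex_mul_relIndex _ _ _ bot_le inf_le_right]

/-- Alternating product along `0 → ker g → ker fg → ker f → coker g → coker fg → coker f → 0`. It is
stated without division so that it also holds with infinite orders read as `0`. -/
theorem card_ker_mul_index_range_comp (f g : M →+ M) :
    (f.comp g).range.index * (Nat.card f.ker * Nat.card g.ker) =
      f.range.index * g.range.index * Nat.card (f.comp g).ker ∧
    (f.range.index ≠ 0 → g.range.index ≠ 0 → (f.comp g).range.index ≠ 0) ∧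
    (Nat.card f.ker ≠ 0 → Nat.card g.ker ≠ 0 → Nat.card (f.comp g).ker ≠ 0) := by
  have h1 : Nat.card f.ker = Nat.card (g.range ⊓ f.ker : AddSubgroup M) * g.range.relIndex f.ker := by
    rw [← AddSubgroup.inf_relIndex_right, ← AddSubgroup.relIndex_bot_left,
      ← AddSubgroup.relIndex_bot_left, AddSubgroup.relIndex_mul_relIndex _ _ _ bot_le inf_le_right]
  have h2 : Nat.card (f.comp g).ker = Nat.card g.ker * Nat.card (g.range ⊓ f.ker : AddSubgroup M) := by
    have : (f.comp g).ker = f.ker.comap g := rfl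
    rw [← AddSubgroup.relIndex_bot_left (f.comp g).ker, this,
      ← AddSubgroup.relIndex_mul_relIndex ⊥ g.ker (f.ker.comap g) bot_le
        (fun x hx => by rw [AddSubgroup.mem_comap, AddMonoidHom.mem_ker.mp hx]; exact zero_mem _),
      AddSubgroup.relIndex_bot_left, AddSubgroup.relIndex_ker, AddSubgroup.map_comap_eq]
  have h3 : g.range.index = g.range.relIndex f.ker * (g.range ⊔ f.ker).index := by
    rw [← AddSubgroup.relIndex_mul_index (H := g.range) (K := g.range ⊔ f.ker) le_sup_left,
      AddSubgroup.relIndex_sup_left]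
  have h4 : (f.comp g).range.index = (g.range ⊔ f.ker).index * f.range.index := by
    rw [← AddMonoidHom.map_range, AddSubgroup.index_map]
  refine ⟨by rw [h1, h2, h3, h4]; ring, fun ha hb => ?_, fun ha hb => ?_⟩
  · rw [h4]; rw [h3] at hb; exact mul_ne_zero (right_ne_zero_of_mul hb) ha
  · rw [h2]; rw [h1] at ha; exact mul_ne_zero hb (left_ne_zero_of_mul ha)

/-- The endomorphism `f` has finite kernel and cokernel, and `#coker f = p ^ μ * #ker f`. -/
structure HasHerbrandExponent (p : ℕ) (f : M →+ M) (μ : ℕ) : Prop where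
  card_ker_ne_zero : Nat.card f.ker ≠ 0
  index_range_ne_zero : f.range.index ≠ 0
  index_range_eq : f.range.index = p ^ μ * Nat.card f.ker

/-- The order `b` of the image of the connecting map occurs once on each side and cancels; it is
nonzero because `ker f''` is finite. -/
theorem HasHerbrandExponent.of_exact {p : ℕ} {μ' μ'' : ℕ}
    {f' : M' →+ M'} {f : M →+ M} {f'' : M'' →+ M''} {i : M' →+ M} {q : M →+ M''}
    (hi : Function.Injective i) (hq : Function.Surjective q) (hiq : i.range = q.ker)
    (hfi : ∀ x, f (i x) = i (f' x)) (hfq : ∀ x, f'' (q x) = q (f x))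
    (h' : HasHerbrandExponent p f' μ') (h'' : HasHerbrandExponent p f'' μ'') :
    HasHerbrandExponent p f (μ' + μ'') := by
  obtain ⟨a, b, c, h1, h2, h3, h4⟩ := exists_snake_card hi hq hiq hfi hfq
  obtain ⟨k', i', e'⟩ := h'
  obtain ⟨k'', i'', e''⟩ := h''
  rw [h1] at k''
  rw [h2] at i'
  have hb := right_ne_zero_of_mul k''
  refine ⟨?_, ?_, ?_⟩
  · rw [h4]; exact mul_ne_zero k' (left_ne_zero_of_mul k'')
  · rw [h3]; exact mul_ne_zero (right_ne_zero_of_mul i') i''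
  · refine mul_left_cancel₀ hb ?_
    rw [h3, h4, e'', h1, ← mul_assoc, ← h2, e', pow_add]
    ring

theorem HasHerbrandExponent.comp {p : ℕ} {f g : M →+ M} {μ ν : ℕ} (hf : HasHerbrandExponent p f μ)
    (hg : HasHerbrandExponent p g ν) : HasHerbrandExponent p (f.comp g) (μ + ν) := by
  obtain ⟨h1, h2, h3⟩ := card_ker_mul_index_range_comp f g
  refine ⟨h3 hf.1 hg.1, h2 hf.2 hg.2, mul_right_cancel₀ (mul_ne_zero hf.1 hg.1) ?_⟩
  rw [h1, hf.3, hg.3, pow_add]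
  ring

theorem card_ker_eq_index_range [Finite M] (f : M →+ M) : Nat.card f.ker = f.range.index := by
  have h1 := f.ker.card_mul_index
  rw [AddSubgroup.index_ker] at h1
  have h2 := f.range.card_mul_index
  rw [← h2, mul_comm] at h1
  exact Nat.eq_of_mul_eq_mul_left Nat.card_pos h1

theorem HasHerbrandExponent.of_finite [Finite M] (p : ℕ) (f : M →+ M) :
    HasHerbrandExponent p f 0 :=
  ⟨Nat.card_pos.ne', by rw [← card_ker_eq_index_range]; exact Nat.card_pos.ne',
    by rw [card_ker_eq_index_range, pow_zero, one_mul]⟩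

theorem HasHerbrandExponent.pow {p : ℕ} {f : AddMonoid.End M} {μ : ℕ} (hf : HasHerbrandExponent p f μ)
    (n : ℕ) : HasHerbrandExponent p (f ^ n : AddMonoid.End M) (μ * n) := by
  induction n with
  | zero =>
    have h1 : (f ^ 0 : AddMonoid.End M) = AddMonoidHom.id M := rfl
    have h2 : (AddMonoidHom.id M).range = ⊤ := AddMonoidHom.range_eq_top.mpr fun x => ⟨x, rfl⟩
    rw [h1]
    refine ⟨?_, ?_, ?_⟩ <;> simp [h2]
  | succ n ih => rw [pow_succ, mul_add, mul_one]; exact ih.comp hf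

section FourTerm

variable {A X E B : Type*} [AddCommGroup A] [AddCommGroup X] [AddCommGroup E] [AddCommGroup B]

/-- The left side is the order of the kernel of `X/τX → E/τE`. In the chain `τX ≤ τX + A ≤ φ⁻¹(τE)`,
injectivity of `τE` makes the lower quotient `A/τA` (because `τX ∩ A = τA`) and the upper one `{e |
τe ∈ φX} / φX`, which is `ker τB`. -/
theorem relIndex_range_comap_range {τA : A →+ A} {τX : X →+ X} {τE : E →+ E} {τB : B →+ B}
    {i : A →+ X} {φ : X →+ E} {q : E →+ B}
    (hi : Function.Injective i) (hiφ : i.range = φ.ker) (hφq : φ.range = q.ker)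
    (hq : Function.Surjective q) (hτi : ∀ x, τX (i x) = i (τA x)) (hτφ : ∀ x, τE (φ x) = φ (τX x))
    (hτq : ∀ x, τB (q x) = q (τE x)) (hτE : Function.Injective τE) :
    τX.range.relIndex (τE.range.comap φ) = τA.range.index * Nat.card τB.ker := by
  have hle : τX.range ⊔ φ.ker ≤ τE.range.comap φ := by
    refine sup_le ?_ fun x hx => ?_
    · rintro _ ⟨x, rfl⟩; exact ⟨φ x, hτφ x⟩
    · rw [AddSubgroup.mem_comap, AddMonoidHom.mem_ker.mp hx]; exact zero_mem _
  rw [← AddSubgroup.relIndex_mul_relIndex _ _ _ le_sup_left hle, AddSubgroup.relIndex_sup_left]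
  congr 1
  · have h1 : τX.range ⊓ φ.ker = τA.range.map i := by
      ext y
      rw [← hiφ]
      simp only [AddSubgroup.mem_inf, AddMonoidHom.mem_range, AddSubgroup.mem_map]
      constructor
      · rintro ⟨⟨x, rfl⟩, ⟨a, ha⟩⟩
        have : x ∈ φ.ker := by
          rw [AddMonoidHom.mem_ker]
          apply hτE
          have : i a ∈ φ.ker := by rw [← hiφ]; exact ⟨a, rfl⟩
          rw [hτφ, ← ha, AddMonoidHom.mem_ker.mp this, map_zero]
        rw [← hiφ] at this
        obtain ⟨b, rfl⟩ := this
        exact ⟨_, ⟨b, rfl⟩, (hτi b).symm⟩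
      · rintro ⟨_, ⟨a, rfl⟩, rfl⟩
        exact ⟨⟨i a, hτi a⟩, ⟨_, rfl⟩⟩
    rw [← AddSubgroup.inf_relIndex_right, h1, ← hiφ, AddMonoidHom.range_eq_map i,
      AddSubgroup.relIndex_map_map_of_injective _ _ hi, AddSubgroup.relIndex_top_right]
  · have h1 : τX.range ⊔ φ.ker = (φ.range.map τE).comap φ := by
      rw [← AddSubgroup.comap_map_eq, AddMonoidHom.map_range, AddMonoidHom.map_range]
      congr 2; ext x; simp [hτφ]
    rw [h1, AddSubgroup.relIndex_comap, AddSubgroup.map_comap_eq, inf_comm, ← AddSubgroup.map_comap_eq,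
      ← AddSubgroup.relIndex_comap, AddSubgroup.comap_map_eq, (AddMonoidHom.ker_eq_bot_iff τE).mpr hτE, sup_bot_eq,
      hφq, AddSubgroup.relIndex_ker]
    congr 2
    ext y
    obtain ⟨x, rfl⟩ := hq y
    simp only [AddMonoidHom.mem_ker, AddSubgroup.mem_map, AddSubgroup.mem_comap, hτq]
    constructor
    · rintro ⟨z, hz, hzx⟩; rw [← hτq, ← hzx, hτq, hz]
    · exact fun h => ⟨x, h, rfl⟩

/-- Split the sequence at `D = φ(X)`. As `σ` is injective on `E`, hence on `D`, the cokernel on `X`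
is an extension of that on `D` by that on `ker φ`. The cokernels on `D` and `E` have the same order,
since on the finite `B` kernel and cokernel do. So `c` is the order of the cokernel on `ker φ`. -/
theorem exists_index_range_eq_mul {σX : X →+ X} {σE : E →+ E} {σB : B →+ B}
    {φ : X →+ E} {q : E →+ B} (hφq : φ.range = q.ker)
    (hq : Function.Surjective q) (hσφ : ∀ x, σE (φ x) = φ (σX x))
    (hσq : ∀ x, σB (q x) = q (σE x)) (hσE : Function.Injective σE) [Finite B] [Finite φ.ker] :
    ∃ c, 0 < c ∧ c ≤ Nat.card φ.ker ∧ σX.range.index = σE.range.index * c := by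
  have hk : ∀ x ∈ φ.ker, σX x ∈ φ.ker := fun x hx => by
    rw [AddMonoidHom.mem_ker, ← hσφ, AddMonoidHom.mem_ker.mp hx, map_zero]
  have hr : ∀ x ∈ φ.range, σE x ∈ φ.range := by
    rintro _ ⟨x, rfl⟩; exact ⟨_, (hσφ x).symm⟩
  let σK : φ.ker →+ φ.ker := (σX.comp φ.ker.subtype).codRestrict φ.ker fun x => hk x x.2
  let σD : φ.range →+ φ.range := (σE.comp φ.range.subtype).codRestrict φ.range fun x => hr x x.2
  have hD : Nat.card σD.ker = 1 := by
    rw [AddSubgroup.card_eq_one, AddMonoidHom.ker_eq_bot_iff]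
    intro x y h
    exact Subtype.ext (hσE (congrArg Subtype.val h))
  have hE : Nat.card σE.ker = 1 := by
    rw [AddSubgroup.card_eq_one, AddMonoidHom.ker_eq_bot_iff]
    exact hσE
  obtain ⟨a, b, c, h1, h2, h3, h4⟩ := exists_snake_card (f' := σK) (f := σX) (f'' := σD) (i := φ.ker.subtype)
    (q := φ.rangeRestrict) Subtype.val_injective φ.rangeRestrict_surjective
    (by rw [AddSubgroup.range_subtype, AddMonoidHom.ker_rangeRestrict]) (fun x => rfl)
    (fun x => Subtype.ext (hσφ x))
  obtain ⟨a', b', c', h1', h2', h3', h4'⟩ := exists_snake_card (f' := σD) (f := σE) (f'' := σB) (i := φ.range.subtype)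
    (q := q) Subtype.val_injective hq (by rw [AddSubgroup.range_subtype, hφq]) (fun x => rfl) hσq
  have hb : b = 1 := Nat.eq_one_of_mul_eq_one_left (h1.symm.trans hD)
  have ha' : a' = 1 := Nat.eq_one_of_mul_eq_one_left (h4'.symm.trans hE)
  rw [ha', one_mul, card_ker_eq_index_range] at h1'
  rw [hb, one_mul] at h2
  refine ⟨c, ?_, ?_, ?_⟩
  · rw [← h2, ← card_ker_eq_index_range]; exact Nat.card_pos
  · rw [← h2]
    exact Nat.le_of_dvd Nat.card_pos σK.range.index_dvd_card
  · rw [h3, h3', h2', h1']; ring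

end FourTerm

end Counting

/-! ### Torsion modules over a ring that modulo `p` behaves like `𝔽_p⟦T⟧` -/

section Parameter

variable {R : Type*} [CommRing R] {p : ℕ} {T : R}

/-- `T` is a parameter modulo `p`: it lies in the radical of `R / p`, its powers have trivial
intersection in `R / p`, and `R / (p, T)` is the prime field. -/
structure IsParameterMod (p : ℕ) (T : R) : Prop where
  exists_inverse : ∀ x, ∃ y, (p : R) ∣ (1 + T * x) * y - 1
  exists_residue : ∀ x, ∃ (a : ℤ) (y : R), (p : R) ∣ x - a - T * y
  separated : ∀ x, (∀ k : ℕ, ∃ y, (p : R) ∣ x - T ^ k * y) → (p : R) ∣ x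

/-- `R / p` behaves like a discrete valuation ring. Take the largest `k` with `T ^ k ∣ x` modulo
`p`, which exists by separatedness. The cofactor has a residue `a` prime to `p`, as otherwise one
more `T` would divide; an integer inverse of `a` turns the cofactor into some `1 + T * _`, which is
invertible. -/
theorem IsParameterMod.exists_eq_pow_mul (hT : IsParameterMod p T) [hp : Fact p.Prime] (x : R)
    (hx : ¬ (p : R) ∣ x) : ∃ (k : ℕ) (y z : R), (p : R) ∣ x - T ^ k * y ∧ (p : R) ∣ y * z - 1 := by
  classical
  have h : ∃ k : ℕ, ¬ ∃ y, (p : R) ∣ x - T ^ k * y := by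
    by_contra! h
    exact hx (hT.separated x h)
  obtain ⟨k, hk⟩ : ∃ k, Nat.find h = k + 1 :=
    Nat.exists_eq_succ_of_ne_zero fun h0 => by
      have := Nat.find_spec h
      rw [h0] at this
      exact this ⟨x, by simp⟩
  have hk1 := Nat.find_spec h
  have hk2 := Nat.find_min h (m := k) (by omega)
  rw [hk] at hk1
  push Not at hk2
  obtain ⟨y, hy⟩ := hk2
  obtain ⟨a, w, hw⟩ := hT.exists_residue y
  have ha : ¬ (p : ℤ) ∣ a := fun ⟨b, hb⟩ => hk1 ⟨w, by
    have h1 : x - T ^ (k + 1) * w = (x - T ^ k * y) + T ^ k * (y - a - T * w) + p * (T ^ k * b) := by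
      rw [hb]; push_cast; ring
    rw [h1]
    exact dvd_add (dvd_add hy (hw.mul_left _)) (dvd_mul_right _ _)⟩
  have hcop : IsCoprime (p : ℤ) a :=
    (Nat.prime_iff_prime_int.mp hp.out).coprime_iff_not_dvd.mpr ha
  obtain ⟨u, v, huv⟩ := hcop
  have huv' : (u : R) * p + v * a = 1 := by exact_mod_cast congrArg (Int.cast : ℤ → R) huv
  obtain ⟨z, hz⟩ := hT.exists_inverse (v * w)
  refine ⟨k, y, v * z, hy, ?_⟩
  have h1 : y * (v * z) - 1 = ((1 + T * (v * w)) * z - 1) + (y - a - T * w) * (v * z)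
      - p * (u * z) := by
    linear_combination z * huv'
  rw [h1]
  exact dvd_sub (dvd_add hz (hw.mul_right _)) (dvd_mul_right _ _)

/-- Every nonzero submodule is generated by the least power of `T` that it contains. -/
theorem IsParameterMod.isNoetherian_quotient (hT : IsParameterMod p T) [Fact p.Prime] :
    IsNoetherian R (R ⧸ Ideal.span {(p : R)}) := by
  classical
  have hmk : ∀ x y : R, (p : R) ∣ x - y →
      (Submodule.Quotient.mk x : R ⧸ Ideal.span {(p : R)}) = Submodule.Quotient.mk y := fun x y h =>
    (Submodule.Quotient.eq _).mpr (Ideal.mem_span_singleton.mpr h)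
  refine ⟨fun N => ?_⟩
  by_cases hN : N = ⊥
  · rw [hN]; exact Submodule.fg_bot
  have key : ∀ x : R, (Submodule.Quotient.mk x : R ⧸ Ideal.span {(p : R)}) ∈ N →
      ¬ (p : R) ∣ x → ∃ (k : ℕ) (y : R), (p : R) ∣ x - T ^ k * y ∧
        (Submodule.Quotient.mk (T ^ k) : R ⧸ Ideal.span {(p : R)}) ∈ N := by
    intro x hx hpx
    obtain ⟨k, y, z, h1, h2⟩ := hT.exists_eq_pow_mul x hpx
    refine ⟨k, y, h1, ?_⟩
    have h3 := N.smul_mem z hx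
    rw [← Submodule.Quotient.mk_smul, hmk (z • x) (T ^ k)] at h3
    · exact h3
    · have : z • x - T ^ k = z * (x - T ^ k * y) + T ^ k * (y * z - 1) := by
        rw [smul_eq_mul]; ring
      rw [this]
      exact dvd_add (h1.mul_left _) (h2.mul_left _)
  obtain ⟨x, hx, hx0⟩ := Submodule.exists_mem_ne_zero_of_ne_bot hN
  have hex : ∃ k : ℕ, (Submodule.Quotient.mk (T ^ k) : R ⧸ Ideal.span {(p : R)}) ∈ N := by
    obtain ⟨x, rfl⟩ := Submodule.Quotient.mk_surjective _ x
    obtain ⟨k, -, -, h⟩ := key x hx fun h => hx0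
      ((Submodule.Quotient.mk_eq_zero _).mpr (Ideal.mem_span_singleton.mpr h))
    exact ⟨k, h⟩
  refine ⟨{Submodule.Quotient.mk (T ^ Nat.find hex)}, le_antisymm ?_ ?_⟩
  · rw [Finset.coe_singleton, Submodule.span_singleton_le_iff_mem]
    exact Nat.find_spec hex
  · intro x hx
    obtain ⟨x, rfl⟩ := Submodule.Quotient.mk_surjective _ x
    rw [Finset.coe_singleton, Submodule.mem_span_singleton]
    by_cases hpx : (p : R) ∣ x
    · exact ⟨0, by rw [zero_smul, eq_comm, Submodule.Quotient.mk_eq_zero]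
                   exact Ideal.mem_span_singleton.mpr hpx⟩
    obtain ⟨k, y, h1, h2⟩ := key x hx hpx
    have hle := Nat.find_min' hex h2
    refine ⟨T ^ (k - Nat.find hex) * y, ?_⟩
    rw [← Submodule.Quotient.mk_smul, eq_comm]
    apply hmk
    rwa [smul_eq_mul, mul_right_comm, ← pow_add, Nat.sub_add_cancel hle]

variable {M : Type*} [AddCommGroup M] [Module R M]

theorem IsParameterMod.isNoetherian_of_smul_eq_zero (hT : IsParameterMod p T) [Fact p.Prime]
    [Module.Finite R M] (hM : ∀ x : M, (p : R) • x = 0) : IsNoetherian R M := by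
  have := hT.isNoetherian_quotient
  obtain ⟨n, s, hs⟩ := Module.Finite.exists_fin (R := R) (M := M)
  let g (i : Fin n) : (R ⧸ Ideal.span {(p : R)}) →ₗ[R] M :=
    Submodule.liftQ _ (LinearMap.toSpanSingleton R M (s i)) (by
      rw [Ideal.span, Submodule.span_singleton_le_iff_mem, LinearMap.mem_ker,
        LinearMap.toSpanSingleton_apply, hM])
  let f : (Fin n → R ⧸ Ideal.span {(p : R)}) →ₗ[R] M := ∑ i, (g i).comp (LinearMap.proj i)
  refine isNoetherian_of_surjective (f := f) ?_
  rw [eq_top_iff, ← hs, Submodule.span_le]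
  rintro _ ⟨i, rfl⟩
  refine ⟨Pi.single i (Submodule.Quotient.mk 1), ?_⟩
  rw [LinearMap.sum_apply, Finset.sum_eq_single i]
  · rw [LinearMap.comp_apply, LinearMap.proj_apply, Pi.single_eq_same]
    exact one_smul R (s i)
  · intro j _ hj
    simp [hj]
  · simp

/-- Induction along `pM ≤ M`. Only `R / p` has to be Noetherian for this, not `R`. -/
theorem IsParameterMod.isNoetherian_of_pow_smul_eq_zero (hT : IsParameterMod p T) [Fact p.Prime]
    (k : ℕ) : ∀ (M : Type _) [AddCommGroup M] [Module R M] [Module.Finite R M]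
    (_ : ∀ x : M, ((p : R) ^ k) • x = 0), IsNoetherian R M := by
  induction k with
  | zero =>
    intro M _ _ _ hM
    have : Subsingleton M := ⟨fun x y => by
      have h1 := hM x
      have h2 := hM y
      rw [pow_zero, one_smul] at h1 h2
      rw [h1, h2]⟩
    infer_instance
  | succ k ih =>
    intro M _ _ _ hM
    let N := LinearMap.range (LinearMap.lsmul R M (p : R))
    have h1 : IsNoetherian R N := by
      have : Module.Finite R N := Module.Finite.range _
      refine ih N ?_
      rintro ⟨_, x, rfl⟩
      apply Subtype.ext
      change (p : R) ^ k • (p : R) • x = 0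
      rw [← mul_smul, ← pow_succ, hM]
    have h2 : IsNoetherian R (M ⧸ N) := by
      refine hT.isNoetherian_of_smul_eq_zero fun x => ?_
      obtain ⟨x, rfl⟩ := Submodule.Quotient.mk_surjective _ x
      rw [← Submodule.Quotient.mk_smul, Submodule.Quotient.mk_eq_zero]
      exact ⟨x, rfl⟩
    exact (isNoetherian_iff_submodule_quotient N).mpr ⟨h1, h2⟩

/-- The ring acts through integer residues, so the module is finitely generated over `ℤ` and killed
by `p`. -/
theorem IsParameterMod.finite_of_smul_eq_zero (hT : IsParameterMod p T) [hp : Fact p.Prime]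
    [Module.Finite R M] (hM : ∀ x : M, (p : R) • x = 0) (hM' : ∀ x : M, T • x = 0) : Finite M := by
  have hsmul : ∀ r : R, ∃ a : ℤ, ∀ x : M, r • x = a • x := by
    intro r
    obtain ⟨a, y, z, hz⟩ := hT.exists_residue r
    refine ⟨a, fun x => ?_⟩
    have : r = a + T * y + p * z := by linear_combination hz
    rw [this, add_smul, add_smul, mul_comm T, mul_comm (p : R), mul_smul, mul_smul, hM, hM', smul_zero,
      smul_zero, add_zero, add_zero, Int.cast_smul_eq_zsmul]
  have h1 : Module.Finite ℤ M := by
    obtain ⟨s, hs⟩ := Module.Finite.fg_top (R := R) (M := M)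
    refine ⟨s, eq_top_iff.mpr fun x _ => ?_⟩
    have hx : x ∈ Submodule.span R (s : Set M) := hs ▸ Submodule.mem_top
    induction hx using Submodule.span_induction with
    | mem x h => exact Submodule.subset_span h
    | zero => exact zero_mem _
    | add x y _ _ hx hy => exact add_mem (hx trivial) (hy trivial)
    | smul r x _ hx =>
      obtain ⟨a, ha⟩ := hsmul r
      rw [ha]; exact Submodule.smul_mem _ _ (hx trivial)
  refine Module.finite_of_fg_torsion M fun x => ?_
  refine ⟨⟨(p : ℤ), mem_nonZeroDivisors_of_ne_zero (by exact_mod_cast hp.out.ne_zero)⟩, ?_⟩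
  have := hM x
  rw [Nat.cast_smul_eq_nsmul] at this
  change (p : ℤ) • x = 0
  rw [natCast_zsmul, this]

theorem exists_card_eq_pow_of_pow_smul_eq_zero [hp : Fact p.Prime] {M : Type*} [AddCommGroup M] [Finite M]
    (k : ℕ) (hM : ∀ x : M, p ^ k • x = 0) : ∃ n, Nat.card M = p ^ n := by
  have : IsPGroup p (Multiplicative M) := fun x => ⟨k, hM x.toAdd⟩
  obtain ⟨n, hn⟩ := IsPGroup.iff_card.mp this
  exact ⟨n, hn⟩

theorem index_range_toAddMonoidEnd (r : R) : (Module.toAddMonoidEnd R M r).range.index =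
    Nat.card (M ⧸ LinearMap.range (LinearMap.lsmul R M r)) := rfl

theorem card_ker_toAddMonoidEnd (r : R) : Nat.card (Module.toAddMonoidEnd R M r).ker =
    Nat.card (LinearMap.ker (LinearMap.lsmul R M r)) := rfl

theorem IsParameterMod.finite_quotient (hT : IsParameterMod p T) [hp : Fact p.Prime]
    [Module.Finite R M] (hM : ∀ x : M, (p : R) • x = 0) :
    Finite (M ⧸ LinearMap.range (LinearMap.lsmul R M T)) := by
  refine hT.finite_of_smul_eq_zero (fun x => ?_) (fun x => ?_)
  · obtain ⟨x, rfl⟩ := Submodule.Quotient.mk_surjective _ x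
    rw [← Submodule.Quotient.mk_smul, hM, Submodule.Quotient.mk_zero]
  · obtain ⟨x, rfl⟩ := Submodule.Quotient.mk_surjective _ x
    rw [← Submodule.Quotient.mk_smul, Submodule.Quotient.mk_eq_zero]
    exact ⟨x, rfl⟩

theorem IsParameterMod.finite_ker (hT : IsParameterMod p T) [hp : Fact p.Prime]
    [Module.Finite R M] (hM : ∀ x : M, (p : R) • x = 0) :
    Finite (LinearMap.ker (LinearMap.lsmul R M T)) := by
  have := hT.isNoetherian_of_smul_eq_zero hM
  exact hT.finite_of_smul_eq_zero (fun x => Subtype.ext (hM x)) (fun x => Subtype.ext x.2)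

theorem exists_ker_pow_eq [IsNoetherian R M] (T : R) :
    ∃ j, LinearMap.ker (LinearMap.lsmul R M (T ^ j)) = LinearMap.ker (LinearMap.lsmul R M (T ^ (j + 1))) := by
  let F : ℕ →o Submodule R M := ⟨fun j => LinearMap.ker (LinearMap.lsmul R M (T ^ j)), by
    refine monotone_nat_of_le_succ fun j x hx => ?_
    change T ^ (j + 1) • x = 0
    rw [pow_succ', mul_smul, show T ^ j • x = 0 from hx, smul_zero]⟩
  obtain ⟨j, hj⟩ := monotone_stabilizes_iff_noetherian.mpr ‹IsNoetherian R M› F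
  exact ⟨j, hj (j + 1) (Nat.le_succ j)⟩

/-- Let `N` be the stable kernel of the powers of `T`. It is finite and contributes exponent `0`. On
`M / N` the operator `T` is injective, so the exponent is read off its finite cokernel, a `p`-group.
-/
theorem IsParameterMod.exists_hasHerbrandExponent_of_smul_eq_zero (hT : IsParameterMod p T) [hp : Fact p.Prime]
    [Module.Finite R M] (hM : ∀ x : M, (p : R) • x = 0) :
    ∃ μ, HasHerbrandExponent p (Module.toAddMonoidEnd R M T) μ := by
  have := hT.isNoetherian_of_smul_eq_zero hM
  obtain ⟨j, hj⟩ := exists_ker_pow_eq (M := M) T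
  set N := LinearMap.ker (LinearMap.lsmul R M (T ^ j)) with hN
  have hfin : ∀ i : ℕ, Nat.card (Module.toAddMonoidEnd R M (T ^ i)).ker ≠ 0 := by
    intro i
    induction i with
    | zero =>
      have : (Module.toAddMonoidEnd R M (T ^ 0)).ker = ⊥ := by
        rw [eq_bot_iff]
        intro x hx
        have hx : T ^ 0 • x = 0 := hx
        rwa [pow_zero, one_smul] at hx
      rw [this]; simp
    | succ i ih =>
      rw [pow_succ, map_mul]
      refine (card_ker_mul_index_range_comp _ _).2.2 ih ?_
      have := hT.finite_ker hM
      rw [card_ker_toAddMonoidEnd]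
      exact Nat.card_pos.ne'
  have hNfin : Finite N := Nat.finite_of_card_ne_zero (hfin j)
  have hQ : ∀ x : M ⧸ N, (p : R) • x = 0 := by
    intro x
    obtain ⟨x, rfl⟩ := Submodule.Quotient.mk_surjective _ x
    rw [← Submodule.Quotient.mk_smul, hM, Submodule.Quotient.mk_zero]
  have hfinQ := hT.finite_quotient hQ
  obtain ⟨μ, hμ⟩ := exists_card_eq_pow_of_pow_smul_eq_zero (p := p) 1
    (M := (M ⧸ N) ⧸ LinearMap.range (LinearMap.lsmul R (M ⧸ N) T)) (fun x => by
      obtain ⟨x, rfl⟩ := Submodule.Quotient.mk_surjective _ x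
      rw [pow_one, ← Nat.cast_smul_eq_nsmul R, ← Submodule.Quotient.mk_smul, hQ, Submodule.Quotient.mk_zero])
  have hker : (Module.toAddMonoidEnd R (M ⧸ N) T).ker = ⊥ := by
    rw [eq_bot_iff]
    intro x hx
    obtain ⟨x, rfl⟩ := Submodule.Quotient.mk_surjective _ x
    have hx : T • (Submodule.Quotient.mk x : M ⧸ N) = 0 := hx
    rw [← Submodule.Quotient.mk_smul, Submodule.Quotient.mk_eq_zero] at hx
    have hx : T ^ j • T • x = 0 := hx
    rw [← mul_smul, ← pow_succ] at hx
    change Submodule.Quotient.mk x = (0 : M ⧸ N)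
    rw [Submodule.Quotient.mk_eq_zero, hj]
    exact hx
  have h2 : HasHerbrandExponent p (Module.toAddMonoidEnd R (M ⧸ N) T) μ := by
    refine ⟨?_, ?_, ?_⟩
    · rw [hker]; simp
    · rw [index_range_toAddMonoidEnd]; exact Nat.card_pos.ne'
    · rw [index_range_toAddMonoidEnd, hμ, hker]; simp
  have h1 := HasHerbrandExponent.of_finite p (Module.toAddMonoidEnd R N T)
  refine ⟨0 + μ, HasHerbrandExponent.of_exact (i := N.subtype.toAddMonoidHom) (q := N.mkQ.toAddMonoidHom)
    Subtype.val_injective N.mkQ_surjective ?_ (fun _ => rfl) (fun _ => rfl) h1 h2⟩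
  ext x
  simp

/-- The Frobenius congruence. It is the source of the factor `p ^ n` in `μ * p ^ n`: on modules
killed by `p`, the operator is the `p ^ n`-th power of `T`. -/
theorem exists_one_add_pow_sub_one [hp : Fact p.Prime] (T : R) (n : ℕ) :
    ∃ r, (1 + T) ^ p ^ n - 1 = T ^ p ^ n + p * r := by
  obtain ⟨r, hr⟩ := exists_add_pow_prime_pow_eq hp.out (1 : R) T n
  exact ⟨T * r, by rw [hr]; ring⟩

/-- Dévissage along `pM ≤ M`: the exponents of the layers add up, and each layer gives a multiple of
`p ^ n` whose coefficient does not depend on `n`. -/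
theorem IsParameterMod.exists_hasHerbrandExponent (hT : IsParameterMod p T) [hp : Fact p.Prime] (k : ℕ) :
    ∀ (M : Type _) [AddCommGroup M] [Module R M] [Module.Finite R M]
    (_ : ∀ x : M, ((p : R) ^ k) • x = 0), ∃ μ, ∀ n,
      HasHerbrandExponent p (Module.toAddMonoidEnd R M ((1 + T) ^ p ^ n - 1)) (μ * p ^ n) := by
  induction k with
  | zero =>
    intro M _ _ _ hM
    have : Subsingleton M := ⟨fun x y => by
      have h1 := hM x
      have h2 := hM y
      rw [pow_zero, one_smul] at h1 h2
      rw [h1, h2]⟩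
    exact ⟨0, fun n => by rw [zero_mul]; exact HasHerbrandExponent.of_finite p _⟩
  | succ k ih =>
    intro M _ _ _ hM
    let N := LinearMap.range (LinearMap.lsmul R M (p : R))
    have : Module.Finite R N := Module.Finite.range _
    obtain ⟨μ, hμ⟩ := ih N (by
      rintro ⟨_, x, rfl⟩
      apply Subtype.ext
      change (p : R) ^ k • (p : R) • x = 0
      rw [← mul_smul, ← pow_succ, hM])
    have hQ : ∀ x : M ⧸ N, (p : R) • x = 0 := fun x => by
      obtain ⟨x, rfl⟩ := Submodule.Quotient.mk_surjective _ x
      rw [← Submodule.Quotient.mk_smul, Submodule.Quotient.mk_eq_zero]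
      exact ⟨x, rfl⟩
    obtain ⟨μ', hμ'⟩ := hT.exists_hasHerbrandExponent_of_smul_eq_zero hQ
    refine ⟨μ + μ', fun n => ?_⟩
    have h2 : HasHerbrandExponent p (Module.toAddMonoidEnd R (M ⧸ N) ((1 + T) ^ p ^ n - 1)) (μ' * p ^ n) := by
      have h3 : Module.toAddMonoidEnd R (M ⧸ N) ((1 + T) ^ p ^ n - 1) =
          (Module.toAddMonoidEnd R (M ⧸ N) T) ^ p ^ n := by
        rw [← map_pow]
        obtain ⟨r, hr⟩ := exists_one_add_pow_sub_one (p := p) T n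
        ext x
        change ((1 + T) ^ p ^ n - 1) • x = T ^ p ^ n • x
        rw [hr, add_smul, mul_smul, hQ, add_zero]
      rw [h3]
      exact hμ'.pow _
    rw [add_mul]
    refine HasHerbrandExponent.of_exact (i := N.subtype.toAddMonoidHom) (q := N.mkQ.toAddMonoidHom)
      Subtype.val_injective N.mkQ_surjective ?_ (fun _ => rfl) (fun _ => rfl) (hμ n) h2
    ext x
    simp

/-- The orders of the coinvariants and invariants under `(1 + T) ^ p ^ n` of a finitely generated
`p`-power torsion module. -/
theorem IsParameterMod.exists_card_asymptotics (hT : IsParameterMod p T) [hp : Fact p.Prime]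
    [Module.Finite R M] (hM : ∀ x : M, ∃ k : ℕ, p ^ k • x = 0) : ∃ μ ν,
      (∀ n, HasHerbrandExponent p (Module.toAddMonoidEnd R M ((1 + T) ^ p ^ n - 1)) (μ * p ^ n)) ∧
      (∀ n, Nat.card (Module.toAddMonoidEnd R M ((1 + T) ^ p ^ n - 1)).ker ≤ p ^ ν) ∧
      ∀ᶠ n in Filter.atTop, Nat.card (Module.toAddMonoidEnd R M ((1 + T) ^ p ^ n - 1)).ker = p ^ ν := by
  -- By commutativity of `R`, a power of `p` that kills finitely many generators kills the whole
  -- module.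
  obtain ⟨k, hk⟩ : ∃ k : ℕ, ∀ x : M, ((p : R) ^ k) • x = 0 := by
    choose e he using hM
    obtain ⟨s, hs⟩ := Module.Finite.fg_top (R := R) (M := M)
    refine ⟨s.sup e, fun x => ?_⟩
    have hx : x ∈ Submodule.span R (s : Set M) := hs ▸ Submodule.mem_top
    induction hx using Submodule.span_induction with
    | mem x h =>
      obtain ⟨d, hd⟩ := pow_dvd_pow (p : R) (Finset.le_sup (f := e) h)
      rw [hd, mul_comm, mul_smul, ← Nat.cast_pow, Nat.cast_smul_eq_nsmul, he, smul_zero]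
    | zero => exact smul_zero _
    | add x y _ _ hx hy => rw [smul_add, hx, hy, add_zero]
    | smul r x _ hx => rw [smul_comm, hx, smul_zero]
  obtain ⟨μ, hμ⟩ := hT.exists_hasHerbrandExponent k M hk
  have := hT.isNoetherian_of_pow_smul_eq_zero k M hk
  -- The kernels increase because `y - 1` divides `y ^ p - 1`. The stable one has order `p ^ ν` and
  -- contains all the others, which gives both the bound for every `n` and the eventual equality.
  let F : ℕ →o Submodule R M := ⟨fun n => LinearMap.ker (LinearMap.lsmul R M ((1 + T) ^ p ^ n - 1)), by
    refine monotone_nat_of_le_succ fun n x hx => ?_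
    have hx : ((1 + T) ^ p ^ n - 1) • x = 0 := hx
    change ((1 + T) ^ p ^ (n + 1) - 1) • x = 0
    obtain ⟨d, hd⟩ := sub_dvd_pow_sub_pow ((1 + T) ^ p ^ n) 1 p
    rw [one_pow] at hd
    rw [pow_succ, pow_mul, hd, mul_comm, mul_smul, hx, smul_zero]⟩
  have hfin : ∀ n, Finite (F n) := fun n => Nat.finite_of_card_ne_zero (hμ n).1
  obtain ⟨N, hN⟩ := monotone_stabilizes_iff_noetherian.mpr ‹IsNoetherian R M› F
  obtain ⟨ν, hν⟩ := exists_card_eq_pow_of_pow_smul_eq_zero (p := p) k (M := F N) (fun x => by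
    have := hk x
    rw [← Nat.cast_smul_eq_nsmul R]
    exact Subtype.ext (by push_cast; exact this))
  refine ⟨μ, ν, hμ, fun n => ?_, ?_⟩
  · rw [← hν, hN (max N n) (le_max_left _ _)]
    exact Nat.card_le_card_of_injective _ (Submodule.inclusion_injective (F.monotone (le_max_right N n)))
  · filter_upwards [Filter.eventually_ge_atTop N] with n hn
    rw [← hν, hN n hn]
    rfl

end Parameter

/-! ### Divisibility in group algebras, coefficient by coefficient -/

section GroupAlgebra

variable (p : ℕ) [Fact p.Prime] {Q : Type*}

/-- The linear equivalence between functions on a finite group and its group algebra. -/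
def funLinearEquivMonoidAlgebra [Finite Q] : (Q → ℤ_[p]) ≃ₗ[ℤ_[p]] MonoidAlgebra ℤ_[p] Q where
  toFun f := .ofCoeff (Finsupp.equivFunOnFinite.symm f)
  invFun x := x.coeff
  map_add' _ _ := MonoidAlgebra.ext (Finsupp.ext fun _ => rfl)
  map_smul' _ _ := MonoidAlgebra.ext (Finsupp.ext fun _ => rfl)
  left_inv _ := rfl
  right_inv x := by ext; rfl

/-- Taking the coefficient at an element, as a linear map. -/
def coeffLinearMap (q : Q) : MonoidAlgebra ℤ_[p] Q →ₗ[ℤ_[p]] ℤ_[p] where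
  toFun x := x.coeff q
  map_add' _ _ := rfl
  map_smul' _ _ := rfl

variable {p}

theorem natCast_dvd_iff_coeff [Finite Q] [Monoid Q] {n : ℕ} {x : MonoidAlgebra ℤ_[p] Q} :
    (n : MonoidAlgebra ℤ_[p] Q) ∣ x ↔ ∀ q, (n : ℤ_[p]) ∣ x.coeff q := by
  constructor
  · rintro ⟨y, rfl⟩ q
    rw [← nsmul_eq_mul]
    exact ⟨y.coeff q, by rw [← nsmul_eq_mul]; rfl⟩
  · intro h
    choose y hy using h
    refine ⟨funLinearEquivMonoidAlgebra p y, MonoidAlgebra.ext (Finsupp.ext fun q => ?_)⟩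
    rw [hy, ← nsmul_eq_mul, ← nsmul_eq_mul, MonoidAlgebra.coeff_smul_apply]
    rfl

theorem eq_of_natCast_mul_eq [Monoid Q] {n : ℕ} (hn : n ≠ 0) {x y : MonoidAlgebra ℤ_[p] Q}
    (h : (n : MonoidAlgebra ℤ_[p] Q) * x = n * y) : x = y := by
  refine MonoidAlgebra.ext (Finsupp.ext fun q => ?_)
  rw [← nsmul_eq_mul, ← nsmul_eq_mul] at h
  have h1 : n • x.coeff q = n • y.coeff q := congrArg (fun z => MonoidAlgebra.coeff z q) h
  rw [nsmul_eq_mul, nsmul_eq_mul] at h1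
  exact mul_left_cancel₀ (by exact_mod_cast hn) h1

end GroupAlgebra

/-! ### Projections to finite levels and closedness of right ideals -/

section Basic

variable (p : ℕ) [Fact p.Prime] {G : Type u} [Group G] [TopologicalSpace G]

/-- The projection `Λ(G) → ℤ_p[G/N]`. -/
def iwasawaProj (N : OpenNormalSubgroup G) :
    IwasawaAlgebra p G →+* MonoidAlgebra ℤ_[p] (G ⧸ N.toSubgroup) :=
  (Pi.evalRingHom _ N).comp (iwasawaSubring p G).subtype

/-- The transition map applied to a projection -/
theorem iwasawaTransition_proj {N M : OpenNormalSubgroup G} (h : N ≤ M) (x : IwasawaAlgebra p G) :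
    iwasawaTransition p h (iwasawaProj p N x) = iwasawaProj p M x :=
  x.2 N M h

variable {p} in
theorem iwasawaAlgebra_ext {x y : IwasawaAlgebra p G} (h : ∀ N, iwasawaProj p N x = iwasawaProj p N y) : x = y :=
  Subtype.ext (funext h)

theorem iwasawaTransition_single {N M : OpenNormalSubgroup G} (h : N ≤ M) (g : G) (r : ℤ_[p]) :
    iwasawaTransition p h (MonoidAlgebra.single (g : G ⧸ N.toSubgroup) r) =
      MonoidAlgebra.single (g : G ⧸ M.toSubgroup) r := by
  rw [iwasawaTransition, MonoidAlgebra.mapDomainRingHom_apply, MonoidAlgebra.mapDomain_single]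
  rfl

/-- The group elements in the Iwasawa algebra. -/
def iwasawaOf : G →* IwasawaAlgebra p G where
  toFun g := ⟨fun N => MonoidAlgebra.single (g : G ⧸ N.toSubgroup) 1, fun _ _ h =>
    iwasawaTransition_single p h g 1⟩
  map_one' := rfl
  map_mul' g g' := by
    refine Subtype.ext (funext fun N => ?_)
    change MonoidAlgebra.single ((g * g' : G) : G ⧸ N.toSubgroup) (1 : ℤ_[p]) =
      MonoidAlgebra.single (g : G ⧸ N.toSubgroup) 1 * MonoidAlgebra.single (g' : G ⧸ N.toSubgroup) 1
    rw [MonoidAlgebra.single_mul_single, mul_one]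
    rfl

theorem iwasawaProj_of (N : OpenNormalSubgroup G) (g : G) :
    iwasawaProj p N (iwasawaOf p g) = MonoidAlgebra.single (g : G ⧸ N.toSubgroup) 1 := rfl

/-- The multiples of a group element in the Iwasawa algebra -/
def iwasawaSingle (g : G) (r : ℤ_[p]) : IwasawaAlgebra p G :=
  ⟨fun N => MonoidAlgebra.single (g : G ⧸ N.toSubgroup) r, fun _ _ h => iwasawaTransition_single p h g r⟩

theorem iwasawaProj_surjective (N : OpenNormalSubgroup G) : Function.Surjective (iwasawaProj p N) := by
  intro x
  induction x using MonoidAlgebra.induction_linear with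
  | zero => exact ⟨0, map_zero _⟩
  | add x y hx hy =>
    obtain ⟨a, rfl⟩ := hx
    obtain ⟨b, rfl⟩ := hy
    exact ⟨a + b, map_add _ _ _⟩
  | single q r =>
    obtain ⟨g, rfl⟩ := QuotientGroup.mk_surjective q
    exact ⟨iwasawaSingle p g r, rfl⟩

theorem iwasawaInclusion_of (U : Subgroup G) (g : U) :
    iwasawaInclusion p U (iwasawaOf p g) = iwasawaOf p (g : G) := by
  refine iwasawaAlgebra_ext fun N => ?_
  change MonoidAlgebra.mapDomainRingHom _ _ (MonoidAlgebra.single _ _) = MonoidAlgebra.single _ _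
  rw [MonoidAlgebra.mapDomainRingHom_apply, MonoidAlgebra.mapDomain_single]
  rfl

variable [IsTopologicalGroup G] [CompactSpace G]

instance finite_quotient_openNormalSubgroup (N : OpenNormalSubgroup G) : Finite (G ⧸ N.toSubgroup) :=
  Subgroup.quotient_finite_of_isOpen N.toSubgroup N.isOpen'

/-- Finitely generated right ideals of the Iwasawa algebra are closed. -/
theorem exists_eq_sum_mul_of_proj {ι : Type*} [Fintype ι] (a : ι → IwasawaAlgebra p G) (x : IwasawaAlgebra p G)
    (h : ∀ N, ∃ b : ι → MonoidAlgebra ℤ_[p] (G ⧸ N.toSubgroup),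
      iwasawaProj p N x = ∑ i, iwasawaProj p N (a i) * b i) :
    ∃ b : ι → IwasawaAlgebra p G, x = ∑ i, a i * b i := by
  let P := ∀ N : OpenNormalSubgroup G, (G ⧸ N.toSubgroup) → ℤ_[p]
  let F (N : OpenNormalSubgroup G) := funLinearEquivMonoidAlgebra p (Q := G ⧸ N.toSubgroup)
  let C : Set P := {f | ∀ (N M : OpenNormalSubgroup G) (h : N ≤ M), iwasawaTransition p h (F N (f N)) = F M (f M)}
  have hcoeff : ∀ (N : OpenNormalSubgroup G) (y z : MonoidAlgebra ℤ_[p] (G ⧸ N.toSubgroup)), y = z ↔ ∀ q, y.coeff q = z.coeff q :=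
    fun N y z => ⟨fun h _ => by rw [h], fun h => MonoidAlgebra.ext (Finsupp.ext h)⟩
  have hC : IsClosed C := by
    simp only [C, Set.ofPred_forall, hcoeff]
    refine isClosed_iInter fun N => isClosed_iInter fun M => isClosed_iInter fun h => isClosed_iInter fun q => ?_
    refine isClosed_eq ?_ ?_
    · let L : MonoidAlgebra ℤ_[p] (G ⧸ N.toSubgroup) →ₗ[ℤ_[p]] MonoidAlgebra ℤ_[p] (G ⧸ M.toSubgroup) :=
        { toFun := iwasawaTransition p h
          map_add' := map_add _
          map_smul' := fun r y => by
            simp only [iwasawaTransition, MonoidAlgebra.mapDomainRingHom_apply, RingHom.id_apply,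
              MonoidAlgebra.mapDomain_smul] }
      exact (((coeffLinearMap p q).comp (L.comp (F N).toLinearMap)).continuous_on_pi).comp (continuous_apply N)
    · exact (continuous_apply q).comp (continuous_apply (A := fun M : OpenNormalSubgroup G => (G ⧸ M.toSubgroup) → ℤ_[p]) M)
  -- The compatible families of coefficients that solve the equation at level `N`. They form a
  -- closed subset of a product of copies of `ℤ_p`, nonempty since `Λ(G)` surjects onto each level,
  -- and they shrink with `N`. By compactness all these sets share a point, which solves the
  -- equation in `Λ(G)`.
  let S (N : OpenNormalSubgroup G) : Set (ι → P) := {b | (∀ i, b i ∈ C) ∧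
    iwasawaProj p N x = ∑ i, iwasawaProj p N (a i) * F N (b i N)}
  have hS : ∀ N, IsClosed (S N) := by
    intro N
    simp only [S, Set.ofPred_and, Set.ofPred_forall, hcoeff]
    refine (isClosed_iInter fun i => hC.preimage (continuous_apply i)).inter (isClosed_iInter fun q => ?_)
    refine isClosed_eq continuous_const ?_
    change Continuous fun b : ι → P => coeffLinearMap p q (∑ i, iwasawaProj p N (a i) * F N (b i N))
    simp only [map_sum]
    refine continuous_finsetSum _ fun i _ => ?_
    exact (((coeffLinearMap p q).comp ((LinearMap.mulLeft ℤ_[p] (iwasawaProj p N (a i))).comp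
      (F N).toLinearMap)).continuous_on_pi).comp ((continuous_apply N).comp (continuous_apply i))
  have hne : ∀ N, (S N).Nonempty := by
    intro N
    obtain ⟨b, hb⟩ := h N
    choose b' hb' using fun i => iwasawaProj_surjective p N (b i)
    refine ⟨fun i M => (F M).symm (iwasawaProj p M (b' i)), fun i M M' hM => ?_, ?_⟩
    · rw [LinearEquiv.apply_symm_apply, LinearEquiv.apply_symm_apply, iwasawaTransition_proj]
    · simp only [LinearEquiv.apply_symm_apply, hb', hb]
  have hmono : ∀ N M, N ≤ M → S N ⊆ S M := by
    rintro N M hNM b ⟨hb, hb'⟩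
    refine ⟨hb, ?_⟩
    rw [← iwasawaTransition_proj p hNM x, hb', map_sum]
    refine Finset.sum_congr rfl fun i _ => ?_
    rw [map_mul, iwasawaTransition_proj, hb i N M hNM]
  have : Nonempty (OpenNormalSubgroup G) := ⟨wholeGroup G⟩
  obtain ⟨b, hb⟩ := IsCompact.nonempty_iInter_of_directed_nonempty_isCompact_isClosed S
    (fun N M => ⟨N ⊓ M, hmono _ _ inf_le_left, hmono _ _ inf_le_right⟩) hne (fun N => (hS N).isCompact) hS
  rw [Set.mem_iInter] at hb
  refine ⟨fun i => ⟨fun N => F N (b i N), (hb (wholeGroup G)).1 i⟩, iwasawaAlgebra_ext fun N => ?_⟩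
  rw [(hb N).2, map_sum]
  refine Finset.sum_congr rfl fun i _ => ?_
  rw [map_mul]
  rfl

end Basic

/-! ### Group rings of finite quotients -/

section FiniteLevel

variable {p : ℕ} [hp : Fact p.Prime]

/-- Each level set of `f` is stable under `σ`, which has `p`-power order and no fixed points, so its
size is divisible by `p`. -/
theorem sum_eq_zero_of_comp_eq {α : Type*} [Fintype α] {n : ℕ} (σ : Function.End α) (hσ : σ ^ p ^ n = 1)
    (hfix : ∀ a, σ a ≠ a) (f : α → ZMod p) (hf : ∀ a, f (σ a) = f a) : ∑ a, f a = 0 := by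
  classical
  rw [← Finset.sum_fiberwise Finset.univ f f]
  refine Finset.sum_eq_zero fun c _ => ?_
  rw [Finset.sum_congr rfl fun a ha => (Finset.mem_filter.mp ha).2, Finset.sum_const]
  let τ : Function.End {a // f a = c} := fun a => ⟨σ a, (hf a).trans a.2⟩
  have hτ : ∀ (k : ℕ) (a : {a // f a = c}), ((τ ^ k) a : α) = (σ ^ k) a := by
    intro k
    induction k with
    | zero => exact fun a => rfl
    | succ k ih =>
      intro a
      rw [pow_succ, pow_succ]
      exact ih (τ a)
  have h1 : τ ^ p ^ n = 1 := by
    funext a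
    exact Subtype.ext ((hτ _ a).trans (congrFun hσ a))
  have h2 := Equiv.Perm.card_fixedPoints_modEq h1
  have h3 : Fintype.card (Function.fixedPoints τ) = 0 := by
    rw [Fintype.card_eq_zero_iff]
    exact ⟨fun a => hfix a.1 (congrArg Subtype.val a.2)⟩
  rw [h3, Fintype.card_subtype] at h2
  rw [nsmul_eq_mul, (ZMod.natCast_eq_zero_iff _ _).mpr ((Nat.modEq_zero_iff_dvd).mp h2), zero_mul]

theorem natCast_dvd_iff_toZMod (x : ℤ_[p]) : (p : ℤ_[p]) ∣ x ↔ PadicInt.toZMod x = 0 := by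
  rw [← RingHom.mem_ker, PadicInt.ker_toZMod, PadicInt.maximalIdeal_eq_span_p, Ideal.mem_span_singleton]

theorem coeff_mapDomain_eq_sum {Q Q' : Type*} [Fintype Q] [DecidableEq Q'] (f : Q → Q') (x : MonoidAlgebra ℤ_[p] Q)
    (y : Q') : (MonoidAlgebra.mapDomain f x).coeff y = ∑ q : {q // f q = y}, x.coeff q := by
  classical
  induction x using MonoidAlgebra.induction_linear with
  | zero => simp
  | add a b ha hb =>
    rw [MonoidAlgebra.mapDomain_add, MonoidAlgebra.coeff_add, Finsupp.add_apply, ha, hb, ← Finset.sum_add_distrib]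
    rfl
  | single q r =>
    rw [MonoidAlgebra.mapDomain_single]
    simp only [MonoidAlgebra.coeff_single, Finsupp.single_apply]
    by_cases h : f q = y
    · rw [if_pos h, Finset.sum_eq_single ⟨q, h⟩]
      · simp
      · intro b _ hb
        rw [if_neg fun h' => hb (Subtype.ext h'.symm)]
      · simp
    · rw [if_neg h, eq_comm]
      refine Finset.sum_eq_zero fun b _ => ?_
      rw [if_neg]
      exact fun h' => h ((congrArg f h').trans b.2)

/-- Modulo `p` the coefficients of `x` are invariant under `g`, hence under `g ^ j`. This element
acts without fixed points on each fibre of `π` and has `p`-power order, so the fibre sums, which are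
the coefficients of the image, vanish modulo `p`. -/
theorem dvd_mapDomain_of_dvd_sub_one_mul {Q Q' : Type*} [Group Q] [Group Q'] [Finite Q] [Finite Q'] (π : Q →* Q')
    {g : Q} {j n : ℕ} (h1 : (g ^ j) ^ p ^ n = 1) (h2 : g ^ j ≠ 1) (h3 : π (g ^ j) = 1)
    {x : MonoidAlgebra ℤ_[p] Q} (hx : (p : MonoidAlgebra ℤ_[p] Q) ∣ (MonoidAlgebra.single g 1 - 1) * x) :
    (p : MonoidAlgebra ℤ_[p] Q') ∣ MonoidAlgebra.mapDomainRingHom ℤ_[p] π x := by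
  classical
  have := Fintype.ofFinite Q
  rw [natCast_dvd_iff_coeff] at hx ⊢
  have hinv : ∀ q, PadicInt.toZMod (x.coeff (g * q)) = PadicInt.toZMod (x.coeff q) := by
    intro q
    have := hx (g * q)
    rw [natCast_dvd_iff_toZMod, sub_mul, one_mul, MonoidAlgebra.coeff_sub, Finsupp.sub_apply,
      MonoidAlgebra.coeff_single_mul_apply, one_mul, inv_mul_cancel_left, map_sub, sub_eq_zero] at this
    exact this.symm
  have hinv' : ∀ (k : ℕ) (q : Q), PadicInt.toZMod (x.coeff (g ^ k * q)) = PadicInt.toZMod (x.coeff q) := by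
    intro k
    induction k with
    | zero => intro q; rw [pow_zero, one_mul]
    | succ k ih => intro q; rw [pow_succ, mul_assoc, ih, hinv]
  intro y
  rw [natCast_dvd_iff_toZMod, MonoidAlgebra.mapDomainRingHom_apply, coeff_mapDomain_eq_sum, map_sum]
  let σ : Function.End {q // π q = y} := fun q => ⟨g ^ j * q, by rw [map_mul, h3, one_mul, q.2]⟩
  have hσ : ∀ (k : ℕ) (a : {q // π q = y}), ((σ ^ k) a : Q) = (g ^ j) ^ k * a := by
    intro k
    induction k with
    | zero => intro a; rw [pow_zero, pow_zero, one_mul]; rfl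
    | succ k ih =>
      intro a
      rw [pow_succ, pow_succ, mul_assoc]
      exact ih (σ a)
  refine sum_eq_zero_of_comp_eq (n := n) σ ?_ (fun a ha => h2 ?_) _ (fun a => hinv' j a)
  · funext a
    refine Subtype.ext ((hσ _ a).trans ?_)
    rw [h1, one_mul]; rfl
  · have := congrArg Subtype.val ha
    exact mul_eq_right.mp this

variable {Q : Type*} [Group Q]

/-- The geometric sum: left multiplication by a power of `u` is trivial modulo the right ideal
generated by `u - 1`. -/
theorem exists_single_sub_one_eq {u q : Q} (k : ℕ) (h : q = u ^ k) (r : ℤ_[p]) (v : Q) :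
    ∃ b, (MonoidAlgebra.single (q * v) r : MonoidAlgebra ℤ_[p] Q) =
      (MonoidAlgebra.single u 1 - 1) * b + MonoidAlgebra.single v r := by
  refine ⟨(∑ i ∈ Finset.range k, MonoidAlgebra.single u 1 ^ i) * MonoidAlgebra.single v r, ?_⟩
  rw [← mul_assoc, mul_geom_sum, sub_mul, one_mul, sub_add_cancel, MonoidAlgebra.single_pow, one_pow,
    MonoidAlgebra.single_mul_single, one_mul, h]

theorem exists_eq_sub_one_mul_add_augmentation {u : Q} (hu : ∀ q : Q, ∃ k : ℕ, q = u ^ k) (x : MonoidAlgebra ℤ_[p] Q) :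
    ∃ b, x = (MonoidAlgebra.single u 1 - 1) * b +
      MonoidAlgebra.single 1 (MonoidAlgebra.lift ℤ_[p] ℤ_[p] Q 1 x) := by
  induction x using MonoidAlgebra.induction_linear with
  | zero => exact ⟨0, by simp⟩
  | add x y hx hy =>
    obtain ⟨a, ha⟩ := hx
    obtain ⟨b, hb⟩ := hy
    refine ⟨a + b, ?_⟩
    rw [map_add, MonoidAlgebra.single_add, mul_add]
    nth_rw 1 [ha, hb]
    abel
  | single q r =>
    obtain ⟨k, hk⟩ := hu q
    obtain ⟨b, hb⟩ := exists_single_sub_one_eq k hk r (1 : Q)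
    refine ⟨b, ?_⟩
    rw [mul_one] at hb
    simpa using hb

/-- For a group element, `q (u - 1) = (u ^ k - 1) q`, and `u - 1` divides `u ^ k - 1` on the left.
-/
theorem exists_mul_sub_one_eq {u : Q} (hu : ∀ q : Q, ∃ k : ℕ, q * u * q⁻¹ = u ^ k) (x : MonoidAlgebra ℤ_[p] Q) :
    ∃ b, x * (MonoidAlgebra.single u 1 - 1) = (MonoidAlgebra.single u 1 - 1) * b := by
  induction x using MonoidAlgebra.induction_linear with
  | zero => exact ⟨0, by simp⟩
  | add x y hx hy =>
    obtain ⟨a, ha⟩ := hx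
    obtain ⟨b, hb⟩ := hy
    exact ⟨a + b, by rw [add_mul, mul_add, ha, hb]⟩
  | single q r =>
    obtain ⟨k, hk⟩ := hu q
    obtain ⟨b, hb⟩ := exists_single_sub_one_eq k hk r q
    refine ⟨b, ?_⟩
    rw [inv_mul_cancel_right] at hb
    rw [mul_sub, MonoidAlgebra.single_mul_single, mul_one, mul_one, hb, add_sub_cancel_right]

end FiniteLevel

/-! ### Augmentation ideals, and `g - 1` as a nonzerodivisor modulo `p ^ m` -/

section Augmentation

variable (p : ℕ) [hp : Fact p.Prime] {G : Type u} [Group G] [TopologicalSpace G]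

/-- The augmentation is defined at the trivial quotient; this allows it to be read off at any finite
level. -/
theorem lift_iwasawaProj (N : OpenNormalSubgroup G) (x : IwasawaAlgebra p G) :
    MonoidAlgebra.lift ℤ_[p] ℤ_[p] _ 1 (iwasawaProj p N x) = iwasawaAugmentation p G x := by
  have hN : N ≤ wholeGroup G := fun _ _ => trivial
  change _ = MonoidAlgebra.lift ℤ_[p] ℤ_[p] _ 1 (iwasawaProj p (wholeGroup G) x)
  rw [← iwasawaTransition_proj p hN]
  generalize iwasawaProj p N x = y
  induction y using MonoidAlgebra.induction_linear with
  | zero => simp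
  | add x y hx hy => rw [map_add, map_add, map_add, hx, hy]
  | single q r =>
    rw [iwasawaTransition, MonoidAlgebra.mapDomainRingHom_apply, MonoidAlgebra.mapDomain_single]
    simp

variable {p}

theorem of_sub_one_mem_ker_augmentation (u : G) :
    iwasawaOf p u - 1 ∈ RingHom.ker (iwasawaAugmentation p G) := by
  rw [RingHom.mem_ker, map_sub, map_one, ← lift_iwasawaProj p (wholeGroup G), iwasawaProj_of, sub_eq_zero]
  simp

variable [IsTopologicalGroup G]

theorem exists_eq_pow_of_denseRange {u : G} (hu : DenseRange fun k : ℕ => u ^ k) (N : OpenNormalSubgroup G)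
    (q : G ⧸ N.toSubgroup) : ∃ k : ℕ, q = (u : G ⧸ N.toSubgroup) ^ k := by
  obtain ⟨g, rfl⟩ := QuotientGroup.mk_surjective q
  have hopen : IsOpen ((fun z => g⁻¹ * z) ⁻¹' (N : Set G)) :=
    N.toOpenSubgroup.isOpen.preimage (continuous_const_mul g⁻¹)
  obtain ⟨k, hk⟩ := hu.exists_mem_open hopen ⟨g, by simp⟩
  refine ⟨k, ?_⟩
  rw [← QuotientGroup.mk_pow]
  exact QuotientGroup.eq.mpr hk

variable [CompactSpace G]

theorem exists_eq_mul_of_proj {a x : IwasawaAlgebra p G} (h : ∀ N, ∃ b, iwasawaProj p N x = iwasawaProj p N a * b) :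
    ∃ b, x = a * b := by
  obtain ⟨b, hb⟩ := exists_eq_sum_mul_of_proj p (fun _ : Unit => a) x fun N => by
    obtain ⟨b, hb⟩ := h N
    exact ⟨fun _ => b, by simpa using hb⟩
  exact ⟨b (), by simpa using hb⟩

theorem exists_eq_mul_add_mul_of_proj {a a' x : IwasawaAlgebra p G}
    (h : ∀ N, ∃ b b', iwasawaProj p N x = iwasawaProj p N a * b + iwasawaProj p N a' * b') :
    ∃ b b', x = a * b + a' * b' := by
  obtain ⟨b, hb⟩ := exists_eq_sum_mul_of_proj p ![a, a'] x fun N => by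
    obtain ⟨b, b', hb⟩ := h N
    exact ⟨![b, b'], by simpa using hb⟩
  exact ⟨b 0, b 1, by simpa using hb⟩

theorem exists_eq_of_mem_ker_augmentation {u : G} (hu : DenseRange fun k : ℕ => u ^ k) {x : IwasawaAlgebra p G}
    (hx : x ∈ RingHom.ker (iwasawaAugmentation p G)) : ∃ b, x = (iwasawaOf p u - 1) * b := by
  refine exists_eq_mul_of_proj fun N => ?_
  obtain ⟨b, hb⟩ := exists_eq_sub_one_mul_add_augmentation (exists_eq_pow_of_denseRange hu N) (iwasawaProj p N x)
  refine ⟨b, ?_⟩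
  rw [lift_iwasawaProj, RingHom.mem_ker.mp hx, MonoidAlgebra.single_zero, add_zero] at hb
  exact hb

/-- This is what makes `(u - 1) X` stable under `Λ(G)`. It is checked at finite levels and passes to
the limit because principal right ideals are closed. -/
theorem exists_iwasawa_mul_sub_one_eq {u : G}
    (hu : ∀ (N : OpenNormalSubgroup G) (g : G), ∃ k : ℕ, ((g * u * g⁻¹ : G) : G ⧸ N.toSubgroup) = (u : G ⧸ N.toSubgroup) ^ k)
    (x : IwasawaAlgebra p G) :
    ∃ y, x * (iwasawaOf p u - 1) = (iwasawaOf p u - 1) * y := by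
  refine exists_eq_mul_of_proj fun N => ?_
  rw [map_mul, map_sub, map_one, iwasawaProj_of]
  refine exists_mul_sub_one_eq (fun q => ?_) _
  obtain ⟨g, rfl⟩ := QuotientGroup.mk_surjective q
  exact hu N g

/-- `g - 1` is a nonzerodivisor modulo powers of `p` on the quotient of the Iwasawa algebra by
a closed normal subgroup `K`, in terms of finite levels. -/
theorem dvd_iwasawaProj_of_dvd_sub_one_mul {K : Subgroup G} {g : G}
    (hK : ∀ z ∉ K, ∃ N : OpenNormalSubgroup G, K ≤ N.toSubgroup ∧ z ∉ N.toSubgroup)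
    (h1 : ∀ N : OpenNormalSubgroup G, ∃ k : ℕ, g ^ p ^ k ∈ N.toSubgroup) (h2 : ∀ k, g ^ p ^ k ∉ K)
    (m : ℕ) (N : OpenNormalSubgroup G) (hN : K ≤ N.toSubgroup) :
    ∃ N' : OpenNormalSubgroup G, K ≤ N'.toSubgroup ∧ ∃ hN' : N' ≤ N, ∀ x : MonoidAlgebra ℤ_[p] (G ⧸ N'.toSubgroup),
      ((p ^ m : ℕ) : MonoidAlgebra ℤ_[p] (G ⧸ N'.toSubgroup)) ∣
        (MonoidAlgebra.single (g : G ⧸ N'.toSubgroup) 1 - 1) * x →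
      ((p ^ m : ℕ) : MonoidAlgebra ℤ_[p] (G ⧸ N.toSubgroup)) ∣ iwasawaTransition p hN' x := by
  induction m generalizing N with
  | zero => exact ⟨N, hN, le_rfl, fun x _ => by simp⟩
  | succ m ih =>
    -- The power `g ^ p ^ k` dies in `G / N`, while `M` is chosen so that it survives in `G / (N ⊓
    -- M)`. The induction hypothesis extracts `p ^ m` at level `N ⊓ M`; after cancelling it,
    -- invariance of the cofactor modulo `p` yields one more factor `p` on descending to `N`.
    obtain ⟨k, hk⟩ := h1 N
    obtain ⟨M, hKM, hM⟩ := hK _ (h2 k)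
    obtain ⟨N', hKN', hN', h⟩ := ih (N ⊓ M) (le_inf hN hKM)
    have hle : N ⊓ M ≤ N := inf_le_left
    refine ⟨N', hKN', hN'.trans hle, fun x hx => ?_⟩
    have hx' : ((p ^ m : ℕ) : MonoidAlgebra ℤ_[p] (G ⧸ N'.toSubgroup)) ∣
        (MonoidAlgebra.single (g : G ⧸ N'.toSubgroup) 1 - 1) * x :=
      (Nat.cast_dvd_cast (pow_dvd_pow p (Nat.le_succ m))).trans hx
    obtain ⟨y, hy⟩ := h x hx'
    have hcomp : iwasawaTransition p (hN'.trans hle) x = iwasawaTransition p hle (iwasawaTransition p hN' x) := by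
      obtain ⟨x, rfl⟩ := iwasawaProj_surjective p N' x
      rw [iwasawaTransition_proj, iwasawaTransition_proj, iwasawaTransition_proj]
    have hdvd := map_dvd (iwasawaTransition p hN') hx
    rw [map_natCast, map_mul, map_sub, map_one, iwasawaTransition_single, hy, pow_succ, Nat.cast_mul, ← mul_assoc,
      ((Nat.cast_commute (p ^ m) _).symm.eq), mul_assoc] at hdvd
    obtain ⟨z, hz⟩ := hdvd
    rw [mul_assoc] at hz
    have hz' := eq_of_natCast_mul_eq (pow_ne_zero m hp.out.ne_zero) hz
    obtain ⟨l, hl⟩ := h1 (N ⊓ M)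
    have hy' : (p : MonoidAlgebra ℤ_[p] (G ⧸ N.toSubgroup)) ∣ iwasawaTransition p hle y := by
      refine dvd_mapDomain_of_dvd_sub_one_mul (j := p ^ k) (n := l) _ (g := (g : G ⧸ (N ⊓ M).toSubgroup)) ?_ ?_ ?_ ⟨z, hz'⟩
      · rw [← pow_mul, mul_comm, pow_mul, ← QuotientGroup.mk_pow, (QuotientGroup.eq_one_iff _).mpr hl, one_pow]
      · rw [← QuotientGroup.mk_pow, ne_eq, QuotientGroup.eq_one_iff]
        exact fun h => hM h.2
      · rw [← QuotientGroup.mk_pow]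
        exact (QuotientGroup.eq_one_iff _).mpr hk
    rw [hcomp, hy, map_mul, map_natCast, pow_succ, Nat.cast_mul]
    exact mul_dvd_mul_left _ hy'

/-- The descent from `N'` to `N` costs nothing for an element of the inverse limit, since the
divisibility is assumed at every level above `K`. -/
theorem dvd_iwasawaProj_of_dvd_iwasawaProj_sub_one_mul {K : Subgroup G} {g : G}
    (hK : ∀ z ∉ K, ∃ N : OpenNormalSubgroup G, K ≤ N.toSubgroup ∧ z ∉ N.toSubgroup)
    (h1 : ∀ N : OpenNormalSubgroup G, ∃ k : ℕ, g ^ p ^ k ∈ N.toSubgroup) (h2 : ∀ k, g ^ p ^ k ∉ K)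
    {m : ℕ} {x : IwasawaAlgebra p G} (hx : ∀ N : OpenNormalSubgroup G, K ≤ N.toSubgroup →
      ((p ^ m : ℕ) : MonoidAlgebra ℤ_[p] (G ⧸ N.toSubgroup)) ∣ iwasawaProj p N ((iwasawaOf p g - 1) * x))
    (N : OpenNormalSubgroup G) (hN : K ≤ N.toSubgroup) :
    ((p ^ m : ℕ) : MonoidAlgebra ℤ_[p] (G ⧸ N.toSubgroup)) ∣ iwasawaProj p N x := by
  obtain ⟨N', hKN', hN', h⟩ := dvd_iwasawaProj_of_dvd_sub_one_mul (p := p) hK h1 h2 m N hN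
  rw [← iwasawaTransition_proj p hN']
  refine h _ ?_
  have := hx N' hKN'
  rwa [map_mul, map_sub, map_one, iwasawaProj_of] at this

end Augmentation

/-! ### Groups isomorphic to `ℤ_p` -/

section PadicGroup

variable {p : ℕ} [hp : Fact p.Prime]

theorem isOpen_ker_toZModPow (n : ℕ) : IsOpen {x : ℤ_[p] | PadicInt.toZModPow n x = 0} := by
  have : {x : ℤ_[p] | PadicInt.toZModPow n x = 0} = Metric.closedBall 0 ((p : ℝ) ^ (-n : ℤ)) := by
    ext x
    rw [Set.mem_ofPred_eq, ← RingHom.mem_ker, PadicInt.ker_toZModPow, ← PadicInt.norm_le_pow_iff_mem_span_pow,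
      mem_closedBall_zero_iff]
  rw [this]
  exact IsUltrametricDist.isOpen_closedBall _ (by have := hp.out.pos; positivity)

variable {U : Type u} [Group U] [TopologicalSpace U]

/-- The topological generator of a group isomorphic to `ℤ_p` that corresponds to `1`. -/
def padicGenerator (e : U ≃ₜ* Multiplicative ℤ_[p]) : U := e.symm (Multiplicative.ofAdd 1)

theorem map_padicGenerator_pow (e : U ≃ₜ* Multiplicative ℤ_[p]) (k : ℕ) :
    (e (padicGenerator e ^ k)).toAdd = (k : ℤ_[p]) := by
  rw [map_pow, padicGenerator, ContinuousMulEquiv.apply_symm_apply, toAdd_pow, toAdd_ofAdd, nsmul_eq_mul, mul_one]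

theorem mul_comm_of_padic (e : U ≃ₜ* Multiplicative ℤ_[p]) (x y : U) : x * y = y * x :=
  e.injective (by rw [map_mul, map_mul, mul_comm])

theorem denseRange_padicGenerator_pow (e : U ≃ₜ* Multiplicative ℤ_[p]) :
    DenseRange fun k : ℕ => padicGenerator e ^ k := by
  have h1 : DenseRange fun k : ℕ => e.symm (Multiplicative.ofAdd (k : ℤ_[p])) :=
    (e.symm.surjective.denseRange).comp
      (f := fun k : ℕ => Multiplicative.ofAdd (k : ℤ_[p])) PadicInt.denseRange_natCast e.symm.continuous
  convert h1 using 2 with k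
  apply e.injective
  rw [ContinuousMulEquiv.apply_symm_apply, ← map_padicGenerator_pow e k, ofAdd_toAdd]

theorem eq_zero_of_padicGenerator_pow_eq_one (e : U ≃ₜ* Multiplicative ℤ_[p]) {k : ℕ}
    (h : padicGenerator e ^ k = 1) : k = 0 := by
  have := map_padicGenerator_pow e k
  rw [h, map_one, toAdd_one] at this
  exact_mod_cast this.symm

theorem exists_padicGenerator_pow_mem (e : U ≃ₜ* Multiplicative ℤ_[p]) {O : Set U} (hO : IsOpen O) (h1 : 1 ∈ O) :
    ∃ k : ℕ, padicGenerator e ^ p ^ k ∈ O := by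
  have h2 : Filter.Tendsto (fun k : ℕ => (p : ℤ_[p]) ^ k) Filter.atTop (nhds 0) := by
    refine tendsto_pow_atTop_nhds_zero_of_norm_lt_one ?_
    rw [PadicInt.norm_p]
    exact inv_lt_one_of_one_lt₀ (by exact_mod_cast hp.out.one_lt)
  have h3 : IsOpen ((fun x : ℤ_[p] => e.symm (Multiplicative.ofAdd x)) ⁻¹' O) :=
    hO.preimage (e.symm.continuous.comp continuous_ofAdd)
  have h4 := h2.eventually (h3.mem_nhds (by
    rw [Set.mem_preimage, ofAdd_zero, map_one]; exact h1))
  obtain ⟨k, hk⟩ := h4.exists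
  refine ⟨k, ?_⟩
  convert hk
  apply e.injective
  rw [ContinuousMulEquiv.apply_symm_apply, ← Nat.cast_pow, ← map_padicGenerator_pow e, ofAdd_toAdd]

theorem exists_pow_eq_iff_toZModPow (e : U ≃ₜ* Multiplicative ℤ_[p]) (n : ℕ) (z : U) :
    (∃ y : U, y ^ p ^ n = z) ↔ PadicInt.toZModPow n (e z).toAdd = 0 := by
  rw [← RingHom.mem_ker, PadicInt.ker_toZModPow, Ideal.mem_span_singleton]
  constructor
  · rintro ⟨y, rfl⟩
    exact ⟨(e y).toAdd, by rw [map_pow, toAdd_pow, nsmul_eq_mul, Nat.cast_pow]⟩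
  · rintro ⟨y, hy⟩
    refine ⟨e.symm (Multiplicative.ofAdd y), e.injective ?_⟩
    rw [map_pow, ContinuousMulEquiv.apply_symm_apply, ← ofAdd_nsmul, nsmul_eq_mul, Nat.cast_pow, ← hy, ofAdd_toAdd]

theorem compactSpace_of_padic (e : U ≃ₜ* Multiplicative ℤ_[p]) : CompactSpace U :=
  have : CompactSpace (Multiplicative ℤ_[p]) := inferInstanceAs (CompactSpace ℤ_[p])
  e.symm.toHomeomorph.compactSpace

end PadicGroup

/-! ### The Iwasawa algebra of `ℤ_p` has the parameter `h - 1` -/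

section Parameter

variable (p : ℕ) [hp : Fact p.Prime] {U : Type u} [Group U] [TopologicalSpace U]

theorem iwasawaAlgebra_mul_comm (hU : ∀ x y : U, x * y = y * x) (x y : IwasawaAlgebra p U) : x * y = y * x := by
  refine iwasawaAlgebra_ext fun N => ?_
  rw [map_mul, map_mul]
  generalize iwasawaProj p N x = a
  generalize iwasawaProj p N y = b
  induction a using MonoidAlgebra.induction_linear with
  | zero => rw [zero_mul, mul_zero]
  | add a a' h h' => rw [add_mul, mul_add, h, h']
  | single q r =>
    induction b using MonoidAlgebra.induction_linear with
    | zero => rw [zero_mul, mul_zero]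
    | add a a' h h' => rw [add_mul, mul_add, h, h']
    | single q' r' =>
      obtain ⟨g, rfl⟩ := QuotientGroup.mk_surjective q
      obtain ⟨g', rfl⟩ := QuotientGroup.mk_surjective q'
      rw [MonoidAlgebra.single_mul_single, MonoidAlgebra.single_mul_single, mul_comm r, ← QuotientGroup.mk_mul,
        ← QuotientGroup.mk_mul, hU]

/-- The Iwasawa algebra of a commutative group is commutative. -/
abbrev iwasawaCommRing (hU : ∀ x y : U, x * y = y * x) : CommRing (IwasawaAlgebra p U) :=
  { (inferInstance : Ring (IwasawaAlgebra p U)) with mul_comm := iwasawaAlgebra_mul_comm p hU }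

variable [IsTopologicalGroup U]

/-- At each finite level some `h ^ p ^ k` is trivial, so `T ^ p ^ k` is divisible by `p` there.
Hence `1 + T x` is inverted modulo `p` by a finite geometric sum, and an element divisible by all
powers of `T` modulo `p` is divisible by `p` at every level. Residues come from the augmentation.
Closedness of right ideals lifts all this to the limit, so no isomorphism with `ℤ_p⟦T⟧` is needed.
-/
theorem isParameterMod_iwasawaOf_sub_one (e : U ≃ₜ* Multiplicative ℤ_[p]) :
    letI := iwasawaCommRing p (mul_comm_of_padic e)
    IsParameterMod p (iwasawaOf p (padicGenerator e) - 1) := by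
  let := iwasawaCommRing p (mul_comm_of_padic e)
  have := compactSpace_of_padic e
  set T : IwasawaAlgebra p U := iwasawaOf p (padicGenerator e) - 1 with hTdef
  have hT : ∀ N : OpenNormalSubgroup U, ∃ k : ℕ, (p : MonoidAlgebra ℤ_[p] (U ⧸ N.toSubgroup)) ∣ iwasawaProj p N (T ^ k) := by
    intro N
    obtain ⟨k, hk⟩ := exists_padicGenerator_pow_mem e N.isOpen' N.one_mem'
    refine ⟨p ^ k, ?_⟩
    obtain ⟨r, hr⟩ := exists_one_add_pow_sub_one (p := p) T k
    rw [hTdef, add_sub_cancel, ← hTdef] at hr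
    have h1 : iwasawaProj p N (iwasawaOf p (padicGenerator e) ^ p ^ k) = 1 := by
      rw [← map_pow, iwasawaProj_of, (QuotientGroup.eq_one_iff _).mpr hk]
      rfl
    have h2 := congrArg (iwasawaProj p N) hr
    rw [map_sub, map_one, h1, sub_self, map_add, map_mul, map_natCast] at h2
    exact ⟨-iwasawaProj p N r, by rw [mul_neg]; exact eq_neg_of_add_eq_zero_left h2.symm⟩
  have hdvd : ∀ x : IwasawaAlgebra p U, (∀ N, (p : MonoidAlgebra ℤ_[p] (U ⧸ N.toSubgroup)) ∣ iwasawaProj p N x) →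
      (p : IwasawaAlgebra p U) ∣ x := by
    intro x hx
    refine exists_eq_mul_of_proj fun N => ?_
    obtain ⟨y, hy⟩ := hx N
    exact ⟨y, by rw [map_natCast, hy]⟩
  refine ⟨fun x => ?_, fun x => ?_, fun x hx => hdvd x fun N => ?_⟩
  · obtain ⟨b, b', hb⟩ := exists_eq_mul_add_mul_of_proj (p := p) (a := 1 + T * x) (a' := (p : IwasawaAlgebra p U))
      (x := 1) fun N => by
        obtain ⟨k, hk⟩ := hT N
        have h1 : (1 + T * x) * (∑ i ∈ Finset.range k, (-(T * x)) ^ i) = 1 - T ^ k * (-x) ^ k := by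
          have := mul_neg_geom_sum (-(T * x)) k
          rw [sub_neg_eq_add] at this
          rw [this, ← mul_pow, mul_neg]
        have h2 := congrArg (iwasawaProj p N) h1
        rw [map_mul, map_sub, map_one, map_mul] at h2
        obtain ⟨z, hz⟩ := hk
        refine ⟨iwasawaProj p N (∑ i ∈ Finset.range k, (-(T * x)) ^ i), z * iwasawaProj p N ((-x) ^ k), ?_⟩
        rw [h2, map_natCast, ← mul_assoc, ← hz, sub_add_cancel, map_one]
    refine ⟨b, -b', ?_⟩
    linear_combination -hb
  · obtain ⟨a, ha⟩ : ∃ a : ℤ, (p : ℤ_[p]) ∣ iwasawaAugmentation p U x - a := by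
      refine ⟨(PadicInt.appr (iwasawaAugmentation p U x) 1 : ℤ), ?_⟩
      have := PadicInt.appr_spec 1 (iwasawaAugmentation p U x)
      rw [pow_one, Ideal.mem_span_singleton] at this
      exact_mod_cast this
    obtain ⟨d, hd⟩ := ha
    obtain ⟨b, b', hb⟩ := exists_eq_mul_add_mul_of_proj (p := p) (a := T) (a' := (p : IwasawaAlgebra p U))
      (x := x - a) fun N => by
        obtain ⟨b, hb⟩ := exists_eq_sub_one_mul_add_augmentation
          (exists_eq_pow_of_denseRange (denseRange_padicGenerator_pow e) N) (iwasawaProj p N x)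
        refine ⟨b, MonoidAlgebra.single 1 d, ?_⟩
        have h1 : (a : MonoidAlgebra ℤ_[p] (U ⧸ N.toSubgroup)) = MonoidAlgebra.single 1 (a : ℤ_[p]) := by
          rw [MonoidAlgebra.intCast_def]
        have h2 : (p : MonoidAlgebra ℤ_[p] (U ⧸ N.toSubgroup)) = MonoidAlgebra.single 1 (p : ℤ_[p]) := by
          rw [MonoidAlgebra.natCast_def]
        rw [map_sub, map_intCast, map_natCast, h1, h2, MonoidAlgebra.single_mul_single, one_mul, ← hd,
          MonoidAlgebra.single_sub, lift_iwasawaProj] at *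
        nth_rw 1 [hb]
        rw [hTdef, map_sub, map_one, iwasawaProj_of]
        abel
    exact ⟨a, b, b', by rw [hb, add_sub_cancel_left]⟩
  · obtain ⟨k, hk⟩ := hT N
    obtain ⟨y, z, hz⟩ := hx k
    have h1 : x = T ^ k * y + p * z := by rw [← hz]; ring
    rw [h1, map_add, map_mul, map_mul, map_natCast]
    exact dvd_add (hk.mul_right _) (dvd_mul_right _ _)

end Parameter

/-! ### The subgroups of `p ^ n`-th powers and their coinvariants -/

section PowSubgroup

variable {p : ℕ} [hp : Fact p.Prime] {G : Type u} [Group G]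

theorem mem_powSubgroup_iff {U : Subgroup G} (hU : ∀ x ∈ U, ∀ y ∈ U, x * y = y * x) {k : ℕ} {z : G} :
    z ∈ powSubgroup U k ↔ ∃ y ∈ U, y ^ k = z := by
  constructor
  · intro hz
    induction hz using Subgroup.closure_induction with
    | mem x hx => exact hx
    | one => exact ⟨1, one_mem _, one_pow _⟩
    | mul x y _ _ hx hy =>
      obtain ⟨a, ha, rfl⟩ := hx
      obtain ⟨b, hb, rfl⟩ := hy
      exact ⟨a * b, mul_mem ha hb, (show Commute a b from hU a ha b hb).mul_pow k⟩
    | inv x _ hx =>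
      obtain ⟨a, ha, rfl⟩ := hx
      exact ⟨a⁻¹, inv_mem ha, inv_pow _ _⟩
  · rintro ⟨y, hy, rfl⟩
    exact Subgroup.subset_closure ⟨y, hy, rfl⟩

theorem pow_mem_powSubgroup {U : Subgroup G} {z : G} (hz : z ∈ U) (k : ℕ) : z ^ k ∈ powSubgroup U k :=
  Subgroup.subset_closure ⟨z, hz, rfl⟩

theorem powSubgroup_le (U : Subgroup G) (k : ℕ) : powSubgroup U k ≤ U := by
  rw [powSubgroup, Subgroup.closure_le]
  rintro _ ⟨y, hy, rfl⟩
  exact pow_mem hy k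

theorem powSubgroup_normal (U : Subgroup G) [hU : U.Normal] (k : ℕ) : (powSubgroup U k).Normal := by
  refine ⟨fun z hz g => ?_⟩
  have : powSubgroup U k ≤ (powSubgroup U k).comap (MulAut.conj g).toMonoidHom := by
    conv_lhs => rw [powSubgroup]
    rw [Subgroup.closure_le]
    rintro _ ⟨y, hy, rfl⟩
    rw [SetLike.mem_coe, Subgroup.mem_comap]
    change g * y ^ k * g⁻¹ ∈ _
    rw [← conj_pow]
    exact pow_mem_powSubgroup (hU.conj_mem y hy g) k
  exact this hz

variable [TopologicalSpace G] {U : Subgroup G} (e : U ≃ₜ* Multiplicative ℤ_[p])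

include e in
theorem mul_comm_of_mem_padic : ∀ x ∈ U, ∀ y ∈ U, x * y = y * x := fun x hx y hy =>
  congrArg Subtype.val (mul_comm_of_padic e ⟨x, hx⟩ ⟨y, hy⟩)

theorem coe_mem_powSubgroup_iff_toZModPow {n : ℕ} (z : U) :
    (z : G) ∈ powSubgroup U (p ^ n) ↔ PadicInt.toZModPow n (e z).toAdd = 0 := by
  rw [mem_powSubgroup_iff (mul_comm_of_mem_padic e), ← exists_pow_eq_iff_toZModPow]
  constructor
  · rintro ⟨y, hy, h⟩; exact ⟨⟨y, hy⟩, Subtype.ext h⟩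
  · rintro ⟨y, rfl⟩; exact ⟨y, y.2, rfl⟩

variable [IsTopologicalGroup G]

theorem denseRange_powSubgroup (k : ℕ) :
    DenseRange fun j : ℕ => (⟨((padicGenerator e : U) : G) ^ k, pow_mem_powSubgroup (padicGenerator e).2 k⟩ : powSubgroup U k) ^ j := by
  let f : U → powSubgroup U k := fun z => ⟨(z : G) ^ k, pow_mem_powSubgroup z.2 k⟩
  have hf : Continuous f := (continuous_subtype_val.pow k).subtype_mk _
  have hf' : Function.Surjective f := by
    rintro ⟨z, hz⟩
    obtain ⟨y, hy, rfl⟩ := (mem_powSubgroup_iff (mul_comm_of_mem_padic e)).mp hz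
    exact ⟨⟨y, hy⟩, rfl⟩
  convert hf'.denseRange.comp (denseRange_padicGenerator_pow e) hf using 2 with j
  apply Subtype.ext
  simp only [f, Function.comp_apply, SubmonoidClass.coe_pow]
  rw [← pow_mul, ← pow_mul, mul_comm]

include e in
theorem isClosed_powSubgroup [T2Space G] (k : ℕ) : IsClosed (powSubgroup U k : Set G) := by
  have := compactSpace_of_padic e
  have h : (powSubgroup U k : Set G) = Set.range fun z : U => (z : G) ^ k := by
    ext z
    rw [SetLike.mem_coe, mem_powSubgroup_iff (mul_comm_of_mem_padic e)]
    simp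
  rw [h]
  exact (isCompact_range (continuous_subtype_val.pow k)).isClosed

/-- Choose an open normal `N` with `N⁻¹ z` disjoint from the closed `K`; then `N K` is open and
normal and misses `z`. -/
theorem exists_openNormalSubgroup_notMem [CompactSpace G] [TotallyDisconnectedSpace G] {K : Subgroup G}
    [K.Normal] (hK : IsClosed (K : Set G)) {z : G} (hz : z ∉ K) :
    ∃ N : OpenNormalSubgroup G, K ≤ N.toSubgroup ∧ z ∉ N.toSubgroup := by
  have hO : IsOpen ((fun w => w⁻¹ * z) ⁻¹' (K : Set G)ᶜ) :=
    hK.isOpen_compl.preimage (by fun_prop)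
  obtain ⟨N, hN⟩ := ProfiniteGrp.exist_openNormalSubgroup_sub_open_nhds_of_one hO (by simpa using hz)
  refine ⟨⟨⟨N.toSubgroup ⊔ K, Subgroup.isOpen_mono le_sup_left N.isOpen'⟩, inferInstance⟩, le_sup_right, fun h => ?_⟩
  obtain ⟨a, ha, b, hb, rfl⟩ := Subgroup.mem_sup_of_normal_left.mp h
  have := hN ha
  simp at this
  exact this hb

/-- The coinvariants under a topologically cyclic group. -/
theorem mem_augmentationSubmodule_iff {V : Subgroup G} [CompactSpace V] (u : V)
    (hu : DenseRange fun j : ℕ => u ^ j)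
    (hcomm : ∀ x : IwasawaAlgebra p G, ∃ y, x * (iwasawaOf p (u : G) - 1) = (iwasawaOf p (u : G) - 1) * y)
    {X : Type u} [AddCommGroup X] [Module (IwasawaAlgebra p G) X] (y : X) :
    y ∈ augmentationSubmodule p V X ↔ ∃ x, y = (iwasawaOf p (u : G) - 1) • x := by
  constructor
  · intro hy
    induction hy using Submodule.span_induction with
    | mem y hy =>
      obtain ⟨a, ha, x, rfl⟩ := hy
      obtain ⟨b, rfl⟩ := exists_eq_of_mem_ker_augmentation hu ha
      refine ⟨iwasawaInclusion p V b • x, ?_⟩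
      rw [← mul_smul, map_mul, map_sub, map_one, iwasawaInclusion_of]
    | zero => exact ⟨0, (smul_zero _).symm⟩
    | add y z _ _ hy hz =>
      obtain ⟨a, rfl⟩ := hy
      obtain ⟨b, rfl⟩ := hz
      exact ⟨a + b, (smul_add _ _ _).symm⟩
    | smul r y _ hy =>
      obtain ⟨a, rfl⟩ := hy
      obtain ⟨s, hs⟩ := hcomm r
      exact ⟨s • a, by rw [← mul_smul, hs, mul_smul]⟩
  · rintro ⟨x, rfl⟩
    refine Submodule.subset_span ⟨iwasawaOf p u - 1, of_sub_one_mem_ker_augmentation u, x, ?_⟩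
    rw [map_sub, map_one, iwasawaInclusion_of]

/-- The isomorphism between the whole group as a subgroup and the group. -/
def topContinuousMulEquiv (U : Type u) [Group U] [TopologicalSpace U] : (⊤ : Subgroup U) ≃ₜ* U :=
  { Subgroup.topEquiv with
    continuous_toFun := continuous_subtype_val
    continuous_invFun := continuous_id.subtype_mk _ }

end PowSubgroup

/-! ### Reduction of `Λ(G)` to functions on an orbit space -/

section CosetMap

variable {p : ℕ} [hp : Fact p.Prime] {G : Type u} [Group G] [TopologicalSpace G] [IsTopologicalGroup G]
  [CompactSpace G]

/-- Reduction modulo `p ^ m` and modulo the right ideal generated by `u - 1` and `v - 1`,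
where `c` is the map to the space of orbits under left multiplication by `u` and `v`. -/
theorem exists_addMonoidHom_of_cosetMap {C : Type*} [Finite C] (c : G → C) (hc : Function.Surjective c)
    (N₀ : OpenNormalSubgroup G) (hN₀ : ∀ g, ∀ z ∈ N₀.toSubgroup, c (g * z) = c g) (u v : G)
    (hu : ∀ g, c (u * g) = c g) (hv : ∀ g, c (v * g) = c g)
    (h : ∀ g g', c g = c g' → ∀ N : OpenNormalSubgroup G, ∃ a b : G, (g : G ⧸ N.toSubgroup) = b * (a * g') ∧
      (∃ k : ℕ, (a : G ⧸ N.toSubgroup) = (u : G ⧸ N.toSubgroup) ^ k) ∧ ∃ k : ℕ, (b : G ⧸ N.toSubgroup) = (v : G ⧸ N.toSubgroup) ^ k) (m : ℕ) :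
    ∃ Θ : IwasawaAlgebra p G →+ (C → ZMod (p ^ m)), Function.Surjective Θ ∧ ∀ x, Θ x = 0 ↔
      ∃ a b d, x = (iwasawaOf p u - 1) * a + (iwasawaOf p v - 1) * b + ((p ^ m : ℕ) : IwasawaAlgebra p G) * d := by
  classical
  have := Fintype.ofFinite C
  let c' (N : OpenNormalSubgroup G) (hN : N ≤ N₀) : G ⧸ N.toSubgroup → C := Quotient.lift c fun g g' hg => by
    have hg : g⁻¹ * g' ∈ N.toSubgroup := QuotientGroup.leftRel_apply.mp hg
    rw [← hN₀ g _ (hN hg), mul_inv_cancel_left]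
  have hc' : ∀ N hN (g : G), c' N hN (g : G ⧸ N.toSubgroup) = c g := fun _ _ _ => rfl
  have htrans : ∀ N hN x, MonoidAlgebra.mapDomain (c' N₀ le_rfl) (iwasawaProj p N₀ x) =
      MonoidAlgebra.mapDomain (c' N hN) (iwasawaProj p N x) := by
    intro N hN x
    rw [← iwasawaTransition_proj p hN]
    generalize iwasawaProj p N x = y
    induction y using MonoidAlgebra.induction_linear with
    | zero => simp
    | add a b ha hb => rw [map_add, MonoidAlgebra.mapDomain_add, MonoidAlgebra.mapDomain_add, ha, hb]
    | single q r =>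
      obtain ⟨g, rfl⟩ := QuotientGroup.mk_surjective q
      rw [iwasawaTransition_single, MonoidAlgebra.mapDomain_single, MonoidAlgebra.mapDomain_single, hc' _ hN, hc' _ le_rfl]
  let Θ : IwasawaAlgebra p G →+ (C → ZMod (p ^ m)) :=
    { toFun := fun x t => PadicInt.toZModPow m ((MonoidAlgebra.mapDomain (c' N₀ le_rfl) (iwasawaProj p N₀ x)).coeff t)
      map_zero' := by ext; simp
      map_add' := fun x y => by
        ext t
        simp only [map_add, MonoidAlgebra.mapDomain_add, MonoidAlgebra.coeff_add, Finsupp.add_apply, Pi.add_apply] }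
  have hΘ : ∀ x t, Θ x t = PadicInt.toZModPow m ((MonoidAlgebra.mapDomain (c' N₀ le_rfl) (iwasawaProj p N₀ x)).coeff t) :=
    fun _ _ => rfl
  have hker : ∀ w : G, (∀ g, c (w * g) = c g) → ∀ a, Θ ((iwasawaOf p w - 1) * a) = 0 := by
    intro w hw a
    funext t
    rw [hΘ, map_mul, map_sub, map_one, iwasawaProj_of, sub_mul, one_mul]
    suffices H : MonoidAlgebra.mapDomain (c' N₀ le_rfl) (MonoidAlgebra.single (w : G ⧸ N₀.toSubgroup) 1 * iwasawaProj p N₀ a -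
        iwasawaProj p N₀ a) = 0 by rw [H]; simp
    generalize iwasawaProj p N₀ a = y
    induction y using MonoidAlgebra.induction_linear with
    | zero => simp
    | add a b ha hb =>
      rw [mul_add, add_sub_add_comm, MonoidAlgebra.mapDomain_add, ha, hb, add_zero]
    | single q r =>
      obtain ⟨g, rfl⟩ := QuotientGroup.mk_surjective q
      rw [MonoidAlgebra.single_mul_single, one_mul, sub_eq_add_neg, ← MonoidAlgebra.single_neg,
        MonoidAlgebra.mapDomain_add, MonoidAlgebra.mapDomain_single,
        MonoidAlgebra.mapDomain_single, ← QuotientGroup.mk_mul, hc' _ le_rfl, hc' _ le_rfl, hw, ← MonoidAlgebra.single_add, add_neg_cancel,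
        MonoidAlgebra.single_zero]
  refine ⟨Θ, fun f => ?_, fun x => ⟨fun hx => ?_, ?_⟩⟩
  · choose s hs using hc
    choose r hr using fun t => ZMod.ringHom_surjective (PadicInt.toZModPow (p := p) m) (f t)
    refine ⟨∑ t, iwasawaSingle p (s t) (r t), ?_⟩
    have h1 : ∀ t, Θ (iwasawaSingle p (s t) (r t)) = Pi.single t (f t) := by
      intro t
      funext t'
      have h2 : iwasawaProj p N₀ (iwasawaSingle p (s t) (r t)) = MonoidAlgebra.single (s t : G ⧸ N₀.toSubgroup) (r t) := rfl
      rw [hΘ, h2, MonoidAlgebra.mapDomain_single, hc' _ le_rfl, hs, MonoidAlgebra.coeff_single, Finsupp.single_apply,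
        Pi.single_apply]
      by_cases ht : t = t'
      · subst ht; simp [hr]
      · rw [if_neg ht, if_neg (Ne.symm ht), map_zero]
    rw [map_sum]
    simp only [h1]
    exact Finset.univ_sum_single f
  · obtain ⟨b, hb⟩ := exists_eq_sum_mul_of_proj p ![iwasawaOf p u - 1, iwasawaOf p v - 1, ((p ^ m : ℕ) : IwasawaAlgebra p G)] x
      fun N => by
        have hN : N ⊓ N₀ ≤ N₀ := inf_le_right
        have hle : N ⊓ N₀ ≤ N := inf_le_left
        choose s hs using hc
        -- At a level below `N₀`, where `c` is defined on the quotient, replace each group element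
        -- by the chosen representative of its orbit. This changes `y` only by the right ideal of `u
        -- - 1` and `v - 1`; what remains has orbit sums as coefficients, and these are divisible by
        -- `p ^ m` if `Θ x = 0`.
        let ρ : C → G ⧸ (N ⊓ N₀).toSubgroup := fun t => (s t : G ⧸ (N ⊓ N₀).toSubgroup)
        have key : ∀ y : MonoidAlgebra ℤ_[p] (G ⧸ (N ⊓ N₀).toSubgroup), ∃ a b,
            y = (MonoidAlgebra.single (u : G ⧸ (N ⊓ N₀).toSubgroup) 1 - 1) * a +
              (MonoidAlgebra.single (v : G ⧸ (N ⊓ N₀).toSubgroup) 1 - 1) * b +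
                MonoidAlgebra.mapDomain ρ (MonoidAlgebra.mapDomain (c' _ hN) y) := by
          intro y
          induction y using MonoidAlgebra.induction_linear with
          | zero => exact ⟨0, 0, by simp⟩
          | add y z hy hz =>
            obtain ⟨a, b, hy⟩ := hy
            obtain ⟨a', b', hz⟩ := hz
            refine ⟨a + a', b + b', ?_⟩
            rw [MonoidAlgebra.mapDomain_add, MonoidAlgebra.mapDomain_add, mul_add, mul_add]
            nth_rw 1 [hy, hz]
            abel
          | single q r =>
            obtain ⟨g, rfl⟩ := QuotientGroup.mk_surjective q
            rw [MonoidAlgebra.mapDomain_single, MonoidAlgebra.mapDomain_single, hc' _ hN]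
            obtain ⟨a, b, hg, ⟨k, hk⟩, ⟨l, hl⟩⟩ := h g (s (c g)) (hs _).symm (N ⊓ N₀)
            obtain ⟨b₁, hb₁⟩ := exists_single_sub_one_eq k hk r (s (c g) : G ⧸ (N ⊓ N₀).toSubgroup)
            obtain ⟨b₂, hb₂⟩ := exists_single_sub_one_eq l hl r ((a : G ⧸ (N ⊓ N₀).toSubgroup) * s (c g))
            refine ⟨b₁, b₂, ?_⟩
            rw [hg, hb₂, hb₁]
            abel
        obtain ⟨a, b, hab⟩ := key (iwasawaProj p _ x)
        rw [← htrans _ hN] at hab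
        have hdvd : ((p ^ m : ℕ) : MonoidAlgebra ℤ_[p] (G ⧸ (N ⊓ N₀).toSubgroup)) ∣ MonoidAlgebra.mapDomain ρ
            (MonoidAlgebra.mapDomain (c' N₀ le_rfl) (iwasawaProj p N₀ x)) := by
          rw [natCast_dvd_iff_coeff]
          intro q
          rw [coeff_mapDomain_eq_sum]
          refine Finset.dvd_sum fun t _ => ?_
          have := congrFun hx t
          rw [hΘ, Pi.zero_apply, ← RingHom.mem_ker, PadicInt.ker_toZModPow, Ideal.mem_span_singleton] at this
          exact_mod_cast this
        obtain ⟨d, hd⟩ := hdvd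
        rw [hd] at hab
        refine ⟨![iwasawaTransition p hle a, iwasawaTransition p hle b, iwasawaTransition p hle d], ?_⟩
        rw [← iwasawaTransition_proj p hle, hab, Fin.sum_univ_three]
        simp only [map_add, map_mul, map_sub, map_one, map_natCast, iwasawaTransition_single, Matrix.cons_val_zero,
          Matrix.cons_val_one, Matrix.cons_val, iwasawaProj_of]
    exact ⟨b 0, b 1, b 2, by simpa [Fin.sum_univ_three] using hb⟩
  · rintro ⟨a, b, d, rfl⟩
    rw [map_add, map_add, hker u hu, hker v hv, ← nsmul_eq_mul, map_nsmul, add_zero, zero_add]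
    funext t
    rw [Pi.smul_apply, nsmul_eq_mul, ZMod.natCast_self, zero_mul, Pi.zero_apply]

end CosetMap

/-! ### Regularity of `h ^ (p ^ n) - 1` and `γ ^ j - 1`; orbits of `H_n` and `Γ_n` on `G` -/

section SemidirectProduct

variable {p : ℕ} [hp : Fact p.Prime] {G : Type u} [Group G] [TopologicalSpace G]

theorem exists_padicGenerator_pow_pow_mem {V : Subgroup G} (e : V ≃ₜ* Multiplicative ℤ_[p]) (j : ℕ)
    (N : OpenNormalSubgroup G) : ∃ k : ℕ, (((padicGenerator e : V) : G) ^ j) ^ p ^ k ∈ N.toSubgroup := by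
  obtain ⟨k, hk⟩ := exists_padicGenerator_pow_mem e (N.restrict V).isOpen' (N.restrict V).one_mem'
  refine ⟨k, ?_⟩
  rw [← pow_mul, mul_comm, pow_mul]
  have h1 : ((padicGenerator e : V) : G) ^ p ^ k ∈ N.toSubgroup := hk
  exact pow_mem h1 j

variable {H : Subgroup G} (eH : H ≃ₜ* Multiplicative ℤ_[p])

/-- The element `h ^ k - 1` of `Λ(G)`, where `h` is a topological generator of `H`. -/
def generatorPowSubOne (k : ℕ) : IwasawaAlgebra p G := iwasawaOf p (((padicGenerator eH : H) : G) ^ k) - 1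

theorem iwasawaProj_generatorPowSubOne (k : ℕ) (N : OpenNormalSubgroup G) :
    iwasawaProj p N (generatorPowSubOne eH k) =
      MonoidAlgebra.single ((((padicGenerator eH : H) : G) ^ k : G) : G ⧸ N.toSubgroup) 1 - 1 := by
  rw [generatorPowSubOne, map_sub, map_one, iwasawaProj_of]

theorem exists_eq_sub_one_mul_add_mapDomain {Q C : Type*} [Group Q] {u : Q} (f : Q → C) (ρ : C → Q)
    (h : ∀ q, ∃ k : ℕ, q = u ^ k * ρ (f q)) (y : MonoidAlgebra ℤ_[p] Q) :
    ∃ a, y = (MonoidAlgebra.single u 1 - 1) * a + MonoidAlgebra.mapDomain ρ (MonoidAlgebra.mapDomain f y) := by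
  induction y using MonoidAlgebra.induction_linear with
  | zero => exact ⟨0, by simp⟩
  | add y z hy hz =>
    obtain ⟨a, hy⟩ := hy
    obtain ⟨b, hz⟩ := hz
    refine ⟨a + b, ?_⟩
    rw [MonoidAlgebra.mapDomain_add, MonoidAlgebra.mapDomain_add, mul_add]
    nth_rw 1 [hy, hz]
    abel
  | single q r =>
    obtain ⟨k, hk⟩ := h q
    obtain ⟨a, ha⟩ := exists_single_sub_one_eq k rfl r (ρ (f q))
    refine ⟨a, ?_⟩
    rw [← hk] at ha
    rw [MonoidAlgebra.mapDomain_single, MonoidAlgebra.mapDomain_single]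
    exact ha

variable [IsTopologicalGroup G]

theorem exists_quotient_eq_pow {V : Subgroup G} {u : V} (hu : DenseRange fun j : ℕ => u ^ j) {z : G} (hz : z ∈ V)
    (N : OpenNormalSubgroup G) : ∃ k : ℕ, (z : G ⧸ N.toSubgroup) = ((u : G) : G ⧸ N.toSubgroup) ^ k := by
  obtain ⟨k, hk⟩ := exists_eq_pow_of_denseRange hu (N.restrict V)
    ((⟨z, hz⟩ : V) : V ⧸ (N.restrict V).toSubgroup)
  refine ⟨k, ?_⟩
  rw [← QuotientGroup.mk_pow] at hk ⊢
  have h1 : (⟨z, hz⟩ : V)⁻¹ * u ^ k ∈ (N.restrict V).toSubgroup := QuotientGroup.eq.mp hk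
  exact QuotientGroup.eq.mpr h1

variable [CompactSpace G]

theorem exists_mul_generatorPowSubOne_eq [hH : H.Normal] (k : ℕ) (x : IwasawaAlgebra p G) :
    ∃ y, x * generatorPowSubOne eH k = generatorPowSubOne eH k * y := by
  refine exists_iwasawa_mul_sub_one_eq (fun N g => ?_) x
  exact exists_quotient_eq_pow (denseRange_powSubgroup eH k)
    ((powSubgroup_normal H k).conj_mem _ (pow_mem_powSubgroup (padicGenerator eH).2 k) g) N

variable [TotallyDisconnectedSpace G]

/-- The case `K = 1` of the nonzerodivisor criterion, applicable as `h` has infinite order: `h ^ (p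
^ n) - 1` acts injectively on `Λ(G) / p ^ m`. -/
theorem exists_eq_natCast_mul_of_generatorPowSubOne_mul (n m : ℕ) {x y : IwasawaAlgebra p G}
    (h : generatorPowSubOne eH (p ^ n) * x = ((p ^ m : ℕ) : IwasawaAlgebra p G) * y) :
    ∃ z, x = ((p ^ m : ℕ) : IwasawaAlgebra p G) * z := by
  have hsep : ∀ z ∉ (⊥ : Subgroup G), ∃ N : OpenNormalSubgroup G, (⊥ : Subgroup G) ≤ N.toSubgroup ∧ z ∉ N.toSubgroup :=
    fun z hz => exists_openNormalSubgroup_notMem (by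
      rw [Subgroup.coe_bot]; exact isClosed_singleton) hz
  refine exists_eq_mul_of_proj fun N => ?_
  have h2 : ∀ k, (((padicGenerator eH : H) : G) ^ p ^ n) ^ p ^ k ∉ (⊥ : Subgroup G) := fun k hk => by
    rw [Subgroup.mem_bot, ← pow_mul, ← pow_add] at hk
    exact pow_ne_zero _ hp.out.ne_zero (eq_zero_of_padicGenerator_pow_eq_one eH (Subtype.ext hk))
  have h3 : ∀ N : OpenNormalSubgroup G, (⊥ : Subgroup G) ≤ N.toSubgroup →
      ((p ^ m : ℕ) : MonoidAlgebra ℤ_[p] (G ⧸ N.toSubgroup)) ∣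
        iwasawaProj p N (generatorPowSubOne eH (p ^ n) * x) := fun N _ => ⟨iwasawaProj p N y, by
      rw [h, map_mul, map_natCast]⟩
  obtain ⟨z, hz⟩ := dvd_iwasawaProj_of_dvd_iwasawaProj_sub_one_mul hsep
    (exists_padicGenerator_pow_pow_mem eH (p ^ n)) h2 h3 N bot_le
  exact ⟨z, by rw [hz, map_natCast]⟩

variable {Γ : Subgroup G} (eΓ : Γ ≃ₜ* Multiplicative ℤ_[p])

/-- The case `K = H_n`: no positive power of `γ` lies in `H`, so `γ ^ j - 1` acts injectively on the
`H_n`-coinvariants of `Λ(G) / p ^ m`. Exponents `j` other than powers of `p` are needed for elements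
of finite submodules. -/
theorem exists_eq_of_generatorPowSubOne_mul [hH : H.Normal] (hHΓ : H.IsComplement' Γ) (n m : ℕ) {j : ℕ} (hj : j ≠ 0)
    {x y z : IwasawaAlgebra p G}
    (h : generatorPowSubOne eΓ j * x = generatorPowSubOne eH (p ^ n) * z + ((p ^ m : ℕ) : IwasawaAlgebra p G) * y) :
    ∃ z y, x = generatorPowSubOne eH (p ^ n) * z + ((p ^ m : ℕ) : IwasawaAlgebra p G) * y := by
  set K := powSubgroup H (p ^ n) with hKdef
  have hKn : K.Normal := powSubgroup_normal H _
  have hsep : ∀ z ∉ K, ∃ N : OpenNormalSubgroup G, K ≤ N.toSubgroup ∧ z ∉ N.toSubgroup :=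
    fun z hz => exists_openNormalSubgroup_notMem (isClosed_powSubgroup eH _) hz
  have hgK : ((padicGenerator eH : H) : G) ^ p ^ n ∈ K := pow_mem_powSubgroup (padicGenerator eH).2 _
  have hx : ∀ N : OpenNormalSubgroup G, K ≤ N.toSubgroup →
      ((p ^ m : ℕ) : MonoidAlgebra ℤ_[p] (G ⧸ N.toSubgroup)) ∣ iwasawaProj p N x := by
    refine dvd_iwasawaProj_of_dvd_iwasawaProj_sub_one_mul hsep (exists_padicGenerator_pow_pow_mem eΓ j)
      (fun k hk => ?_) (fun N hN => ⟨iwasawaProj p N y, ?_⟩)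
    · rw [← pow_mul] at hk
      have h1 : ((padicGenerator eΓ : Γ) : G) ^ (j * p ^ k) ∈ (⊥ : Subgroup G) :=
        hHΓ.disjoint.le_bot ⟨powSubgroup_le _ _ hk, pow_mem (padicGenerator eΓ).2 _⟩
      exact mul_ne_zero hj (pow_ne_zero _ hp.out.ne_zero)
        (eq_zero_of_padicGenerator_pow_eq_one eΓ (Subtype.ext (Subgroup.mem_bot.mp h1)))
    · have := congrArg (iwasawaProj p N) h
      rw [map_add, map_mul _ _ y, map_mul _ _ z, iwasawaProj_generatorPowSubOne,
        (QuotientGroup.eq_one_iff _).mpr (hN hgK), ← MonoidAlgebra.one_def, sub_self, zero_mul, zero_add,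
        map_natCast] at this
      exact this
  refine exists_eq_mul_add_mul_of_proj fun N => ?_
  -- The divisibility is known only at levels containing `K`. Modulo the right ideal of `h ^ (p ^ n)
  -- - 1`, the image of `x` at level `N` is the lift along `ρ` of its image at level `N K`, which is
  -- divisible by `p ^ m`.
  let M : OpenNormalSubgroup G :=
    ⟨⟨N.toSubgroup ⊔ K, Subgroup.isOpen_mono le_sup_left N.isOpen'⟩, inferInstance⟩
  have hNM : N ≤ M := show N.toSubgroup ≤ N.toSubgroup ⊔ K from le_sup_left
  obtain ⟨w, hw⟩ := hx M (show K ≤ N.toSubgroup ⊔ K from le_sup_right)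
  let π : G ⧸ N.toSubgroup → G ⧸ M.toSubgroup := QuotientGroup.map N.toSubgroup M.toSubgroup (MonoidHom.id G) hNM
  let ρ : G ⧸ M.toSubgroup → G ⧸ N.toSubgroup := fun q => (q.out : G)
  obtain ⟨a, ha⟩ := exists_eq_sub_one_mul_add_mapDomain (p := p) (u := ((((padicGenerator eH : H) : G) ^ p ^ n : G) : G ⧸ N.toSubgroup))
    π ρ (fun q => by
      obtain ⟨g, rfl⟩ := QuotientGroup.mk_surjective q
      set g' : G := (π (g : G ⧸ N.toSubgroup)).out with hg'
      have h1 : ((g' : G) : G ⧸ M.toSubgroup) = (g : G ⧸ M.toSubgroup) := QuotientGroup.out_eq' _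
      have h2 : g * g'⁻¹ ∈ M.toSubgroup := by
        rw [← QuotientGroup.eq_one_iff, QuotientGroup.mk_mul, QuotientGroup.mk_inv, h1, mul_inv_cancel]
      have h3 : g * g'⁻¹ ∈ K ⊔ N.toSubgroup := by rw [sup_comm]; exact h2
      obtain ⟨κ, hκ, ν, hν, h4⟩ := Subgroup.mem_sup_of_normal_left.mp h3
      obtain ⟨k, hk⟩ := exists_quotient_eq_pow (denseRange_powSubgroup eH (p ^ n)) hκ N
      refine ⟨k, ?_⟩
      change (g : G ⧸ N.toSubgroup) = _ * (g' : G ⧸ N.toSubgroup)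
      rw [← hk, ← mul_inv_eq_iff_eq_mul, ← QuotientGroup.mk_inv, ← QuotientGroup.mk_mul, ← h4, QuotientGroup.mk_mul,
        (QuotientGroup.eq_one_iff ν).mpr hν, mul_one]) (iwasawaProj p N x)
  have h5 : MonoidAlgebra.mapDomain π (iwasawaProj p N x) = iwasawaProj p M x := iwasawaTransition_proj p hNM x
  rw [h5, hw, ← nsmul_eq_mul] at ha
  refine ⟨a, MonoidAlgebra.mapDomain ρ w, ?_⟩
  rw [iwasawaProj_generatorPowSubOne, map_natCast, ← nsmul_eq_mul]
  refine ha.trans (congrArg _ ?_)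
  let D : MonoidAlgebra ℤ_[p] (G ⧸ M.toSubgroup) →+ MonoidAlgebra ℤ_[p] (G ⧸ N.toSubgroup) :=
    ⟨⟨MonoidAlgebra.mapDomain ρ, MonoidAlgebra.mapDomain_zero _⟩, MonoidAlgebra.mapDomain_add _⟩
  exact map_nsmul D _ w

include eH eΓ in
/-- The map to the set of orbits under left multiplication by `H ^ (p ^ n)` and `Γ ^ (p ^ n)`. -/
theorem exists_cosetMap [hH : H.Normal] (hHΓ : H.IsComplement' Γ) (n : ℕ) :
    ∃ c : G → ZMod (p ^ n) × ZMod (p ^ n), Function.Surjective c ∧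
      (∃ N : OpenNormalSubgroup G, ∀ g, ∀ z ∈ N.toSubgroup, c (g * z) = c g) ∧
      (∀ a ∈ powSubgroup H (p ^ n), ∀ g, c (a * g) = c g) ∧ (∀ a ∈ powSubgroup Γ (p ^ n), ∀ g, c (a * g) = c g) ∧
      ∀ g g', c g = c g' → ∃ a ∈ powSubgroup H (p ^ n), ∃ b ∈ powSubgroup Γ (p ^ n), g = b * (a * g') := by
  have := compactSpace_of_padic eH
  have := compactSpace_of_padic eΓ
  -- With the `Γ`-factor on the left, `Γ_n` translates the first coordinate only, and `a ∈ H_n`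
  -- translates the second one by `s⁻¹ a s`, again in `H_n`. The orbits are therefore separated by
  -- the two coordinates modulo `p ^ n`.
  let f : Γ × H ≃ G := Equiv.ofBijective (fun x => (x.1 : G) * x.2) hHΓ.symm
  have hf : Continuous f :=
    (continuous_subtype_val.comp continuous_fst).mul (continuous_subtype_val.comp continuous_snd)
  let φ : Γ × H ≃ₜ G := hf.homeoOfEquivCompactToT2
  have hφ : ∀ a b, φ (a, b) = a * b := fun _ _ => rfl
  let c' : Γ × H → ZMod (p ^ n) × ZMod (p ^ n) := fun x =>
    (PadicInt.toZModPow n (eΓ x.1).toAdd, PadicInt.toZModPow n (eH x.2).toAdd)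
  have hc' : ∀ a b, c' (a, b) = (PadicInt.toZModPow n (eΓ a).toAdd, PadicInt.toZModPow n (eH b).toAdd) :=
    fun _ _ => rfl
  have hΓ1 : ∀ (a : G) (ha : a ∈ powSubgroup Γ (p ^ n)) (g : G), c' (φ.symm (a * g)) = c' (φ.symm g) := by
    intro a ha g
    obtain ⟨⟨s, t⟩, rfl⟩ := φ.surjective g
    have h1 : a * φ (s, t) = φ (⟨a, powSubgroup_le _ _ ha⟩ * s, t) := by
      rw [hφ, hφ, Subgroup.coe_mul, mul_assoc]
    rw [h1, φ.symm_apply_apply, φ.symm_apply_apply, hc', hc', map_mul, toAdd_mul, map_add,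
      (coe_mem_powSubgroup_iff_toZModPow eΓ ⟨a, powSubgroup_le _ _ ha⟩).mp ha, zero_add]
  have hH1 : ∀ (a : G) (ha : a ∈ powSubgroup H (p ^ n)) (g : G), c' (φ.symm (a * g)) = c' (φ.symm g) := by
    intro a ha g
    obtain ⟨⟨s, t⟩, rfl⟩ := φ.surjective g
    have ha' : (s : G)⁻¹ * a * s ∈ powSubgroup H (p ^ n) := by
      have := (powSubgroup_normal H (p ^ n)).conj_mem a ha (s : G)⁻¹
      rwa [inv_inv] at this
    have h1 : a * φ (s, t) = φ (s, ⟨_, powSubgroup_le _ _ ha'⟩ * t) := by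
      rw [hφ, hφ, Subgroup.coe_mul]
      group
    rw [h1, φ.symm_apply_apply, φ.symm_apply_apply, hc', hc', map_mul, toAdd_mul, map_add,
      (coe_mem_powSubgroup_iff_toZModPow eH ⟨_, powSubgroup_le _ _ ha'⟩).mp ha', zero_add]
  refine ⟨fun g => c' (φ.symm g), ?_, ?_, hH1, hΓ1, ?_⟩
  · rintro ⟨s, t⟩
    obtain ⟨s, rfl⟩ := ZMod.ringHom_surjective (PadicInt.toZModPow (p := p) n) s
    obtain ⟨t, rfl⟩ := ZMod.ringHom_surjective (PadicInt.toZModPow (p := p) n) t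
    refine ⟨φ (eΓ.symm (Multiplicative.ofAdd s), eH.symm (Multiplicative.ofAdd t)), ?_⟩
    change c' _ = _
    rw [φ.symm_apply_apply, hc', ContinuousMulEquiv.apply_symm_apply, ContinuousMulEquiv.apply_symm_apply,
      toAdd_ofAdd, toAdd_ofAdd]
  · have hO : IsOpen {g : G | c' (φ.symm g) = 0} := by
      have h1 : IsOpen {x : ℤ_[p] × ℤ_[p] | PadicInt.toZModPow n x.1 = 0 ∧ PadicInt.toZModPow n x.2 = 0} :=
        ((isOpen_ker_toZModPow n).preimage continuous_fst).inter ((isOpen_ker_toZModPow n).preimage continuous_snd)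
      have h2 : Continuous fun g : G => ((eΓ (φ.symm g).1).toAdd, (eH (φ.symm g).2).toAdd) :=
        (continuous_toAdd.comp (eΓ.continuous.comp (continuous_fst.comp φ.symm.continuous))).prodMk
          (continuous_toAdd.comp (eH.continuous.comp (continuous_snd.comp φ.symm.continuous)))
      convert h1.preimage h2 using 1
      ext g
      exact Prod.ext_iff
    have h1 : (1 : G) ∈ {g : G | c' (φ.symm g) = 0} := by
      have : (1 : G) = φ (1, 1) := by rw [hφ]; simp
      rw [Set.mem_ofPred_eq, this, φ.symm_apply_apply, hc', map_one eΓ, map_one eH, toAdd_one, map_zero]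
      rfl
    obtain ⟨N, hN⟩ := ProfiniteGrp.exist_openNormalSubgroup_sub_open_nhds_of_one hO h1
    refine ⟨N, fun g z hz => ?_⟩
    have h2 : g * z * g⁻¹ ∈ N.toSubgroup := N.isNormal'.conj_mem z hz g
    have h3 : c' (φ.symm (g * z * g⁻¹)) = 0 := hN h2
    -- Moving `z` to the left turns it into an element of `N` with zero coordinates, hence a product
    -- of elements of `Γ_n` and `H_n`, under which `c` is invariant.
    have h4 : g * z = g * z * g⁻¹ * g := by group
    rw [h4]
    generalize g * z * g⁻¹ = w at h3
    obtain ⟨⟨s, t⟩, rfl⟩ := φ.surjective w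
    rw [φ.symm_apply_apply, hc'] at h3
    change c' _ = c' _
    rw [hφ, mul_assoc, hΓ1 _ ((coe_mem_powSubgroup_iff_toZModPow eΓ s).mpr (congrArg Prod.fst h3)),
      hH1 _ ((coe_mem_powSubgroup_iff_toZModPow eH t).mpr (congrArg Prod.snd h3))]
  · intro g g' h
    obtain ⟨⟨s, t⟩, rfl⟩ := φ.surjective g
    obtain ⟨⟨s', t'⟩, rfl⟩ := φ.surjective g'
    simp only [φ.symm_apply_apply, hc', Prod.mk.injEq] at h
    refine ⟨s' * (t * t'⁻¹ : H) * (s' : G)⁻¹, (powSubgroup_normal H (p ^ n)).conj_mem _ ?_ _, (s * s'⁻¹ : Γ), ?_, ?_⟩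
    · rw [coe_mem_powSubgroup_iff_toZModPow eH, map_mul, map_inv, toAdd_mul, toAdd_inv, map_add, map_neg, h.2,
        add_neg_cancel]
    · rw [coe_mem_powSubgroup_iff_toZModPow eΓ, map_mul, map_inv, toAdd_mul, toAdd_inv, map_add, map_neg, h.1,
        add_neg_cancel]
    · rw [hφ, hφ]
      push_cast
      group

end SemidirectProduct

/-! ### The elementary module: injectivity and order of the double coinvariants -/

section ElementaryModule

variable {p : ℕ} [hp : Fact p.Prime] {G : Type u} [Group G] [TopologicalSpace G]

theorem mem_span_pow_iff (k : ℕ) (x : IwasawaAlgebra p G) :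
    x ∈ Submodule.span (IwasawaAlgebra p G) {(p : IwasawaAlgebra p G) ^ k} ↔
      ∃ z, x = ((p ^ k : ℕ) : IwasawaAlgebra p G) * z := by
  rw [Submodule.mem_span_singleton]
  constructor
  · rintro ⟨a, rfl⟩
    exact ⟨a, by rw [smul_eq_mul, ← Nat.cast_pow, (Nat.cast_commute (p ^ k) a).eq]⟩
  · rintro ⟨z, rfl⟩
    exact ⟨z, by rw [smul_eq_mul, ← Nat.cast_pow, (Nat.cast_commute (p ^ k) z).eq]⟩

theorem exists_mk_eq {s : ℕ} {m : Fin s → ℕ} (e : ElementaryModule p G m) :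
    ∃ x : Fin s → IwasawaAlgebra p G, e = fun i => Submodule.Quotient.mk (x i) := by
  choose x hx using fun i => Submodule.Quotient.mk_surjective _ (e i)
  exact ⟨x, funext fun i => (hx i).symm⟩

theorem exists_pow_smul_elementaryModule_eq_zero {s : ℕ} {m : Fin s → ℕ} (e : ElementaryModule p G m) :
    p ^ (∑ i, m i) • e = 0 := by
  obtain ⟨x, rfl⟩ := exists_mk_eq e
  funext i
  rw [Pi.smul_apply, Pi.zero_apply, ← Nat.cast_smul_eq_nsmul (IwasawaAlgebra p G), ← Submodule.Quotient.mk_smul,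
    Submodule.Quotient.mk_eq_zero, mem_span_pow_iff]
  obtain ⟨d, hd⟩ := pow_dvd_pow p (Finset.single_le_sum (f := m) (fun _ _ => Nat.zero_le _) (Finset.mem_univ i))
  exact ⟨d * x i, by rw [hd, smul_eq_mul, Nat.cast_mul, mul_assoc]⟩

variable [IsTopologicalGroup G] [CompactSpace G] [TotallyDisconnectedSpace G]
variable {H Γ : Subgroup G} (eH : H ≃ₜ* Multiplicative ℤ_[p]) (eΓ : Γ ≃ₜ* Multiplicative ℤ_[p])

theorem eq_zero_of_generatorPowSubOne_smul_eq_zero (n : ℕ) {s : ℕ} {m : Fin s → ℕ} {e : ElementaryModule p G m}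
    (h : generatorPowSubOne eH (p ^ n) • e = 0) : e = 0 := by
  obtain ⟨x, rfl⟩ := exists_mk_eq e
  funext i
  have hi := congrFun h i
  rw [Pi.smul_apply, Pi.zero_apply, ← Submodule.Quotient.mk_smul, Submodule.Quotient.mk_eq_zero, mem_span_pow_iff] at hi
  obtain ⟨z, hz⟩ := hi
  rw [Pi.zero_apply, Submodule.Quotient.mk_eq_zero, mem_span_pow_iff]
  exact exists_eq_natCast_mul_of_generatorPowSubOne_mul eH n (m i) hz

theorem exists_eq_smul_of_generatorPowSubOne_smul [H.Normal] (hHΓ : H.IsComplement' Γ) (n : ℕ) {j : ℕ} (hj : j ≠ 0)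
    {s : ℕ} {m : Fin s → ℕ} {e z : ElementaryModule p G m}
    (h : generatorPowSubOne eΓ j • e = generatorPowSubOne eH (p ^ n) • z) :
    ∃ z, e = generatorPowSubOne eH (p ^ n) • z := by
  obtain ⟨x, rfl⟩ := exists_mk_eq e
  obtain ⟨z, rfl⟩ := exists_mk_eq z
  have key : ∀ i, ∃ w y, x i = generatorPowSubOne eH (p ^ n) * w + ((p ^ m i : ℕ) : IwasawaAlgebra p G) * y := by
    intro i
    have hi := congrFun h i
    rw [Pi.smul_apply, Pi.smul_apply, ← Submodule.Quotient.mk_smul, ← Submodule.Quotient.mk_smul,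
      Submodule.Quotient.eq, mem_span_pow_iff] at hi
    obtain ⟨y, hy⟩ := hi
    exact exists_eq_of_generatorPowSubOne_mul eH eΓ hHΓ n (m i) hj (sub_eq_iff_eq_add'.mp hy)
  choose w y hwy using key
  refine ⟨fun i => Submodule.Quotient.mk (w i), funext fun i => ?_⟩
  rw [Pi.smul_apply, ← Submodule.Quotient.mk_smul, Submodule.Quotient.eq, mem_span_pow_iff]
  exact ⟨y i, by rw [hwy i, smul_eq_mul, add_sub_cancel_left]⟩

/-- The quotient is the product over `i` of the functions from the `p ^ (2 * n)` orbits to `ZMod (p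
^ m i)`. An arbitrary subgroup `S` described by its elements is allowed, so that the preimage of
`I_{Γ_n} E_{H_n}` in `E` can be inserted directly. -/
theorem index_elementaryModule [H.Normal] (hHΓ : H.IsComplement' Γ) (n : ℕ)
    {s : ℕ} {m : Fin s → ℕ} (S : AddSubgroup (ElementaryModule p G m))
    (hS : ∀ e, e ∈ S ↔ ∃ a b, e = generatorPowSubOne eH (p ^ n) • a + generatorPowSubOne eΓ (p ^ n) • b) :
    S.index = p ^ ((∑ i, m i) * p ^ (2 * n)) := by
  obtain ⟨c, hc, ⟨N, hN⟩, hcH, hcΓ, hcc⟩ := exists_cosetMap eH eΓ hHΓ n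
  have hΘ := exists_addMonoidHom_of_cosetMap (p := p) c hc N hN (((padicGenerator eH : H) : G) ^ p ^ n)
    (((padicGenerator eΓ : Γ) : G) ^ p ^ n) (hcH _ (pow_mem_powSubgroup (padicGenerator eH).2 _))
    (hcΓ _ (pow_mem_powSubgroup (padicGenerator eΓ).2 _)) (fun g g' h M => by
      obtain ⟨a, ha, b, hb, hg⟩ := hcc g g' h
      exact ⟨a, b, by rw [hg]; rfl, exists_quotient_eq_pow (denseRange_powSubgroup eH (p ^ n)) ha M,
        exists_quotient_eq_pow (denseRange_powSubgroup eΓ (p ^ n)) hb M⟩)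
  choose Θ hΘsurj hΘker using hΘ
  let q : (Fin s → IwasawaAlgebra p G) →+ ElementaryModule p G m :=
    { toFun := fun x i => Submodule.Quotient.mk (x i)
      map_zero' := rfl
      map_add' := fun _ _ => rfl }
  have hq : Function.Surjective q := fun e => by
    obtain ⟨x, rfl⟩ := exists_mk_eq e
    exact ⟨x, rfl⟩
  let Φ : (Fin s → IwasawaAlgebra p G) →+ ∀ i : Fin s, ZMod (p ^ n) × ZMod (p ^ n) → ZMod (p ^ m i) :=
    { toFun := fun x i => Θ (m i) (x i)
      map_zero' := funext fun i => map_zero _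
      map_add' := fun x y => funext fun i => map_add _ _ _ }
  have hΦ : Φ.range = ⊤ := AddMonoidHom.range_eq_top.mpr fun f => by
    choose x hx using fun i => hΘsurj (m i) (f i)
    exact ⟨x, funext hx⟩
  have hker : S.comap q = Φ.ker := by
    ext x
    rw [AddSubgroup.mem_comap, hS, AddMonoidHom.mem_ker]
    constructor
    · rintro ⟨a, b, hab⟩
      obtain ⟨a, rfl⟩ := exists_mk_eq a
      obtain ⟨b, rfl⟩ := exists_mk_eq b
      funext i
      have hi := congrFun hab i
      refine (hΘker (m i) (x i)).mpr ?_
      rw [Pi.add_apply, Pi.smul_apply, Pi.smul_apply, ← Submodule.Quotient.mk_smul, ← Submodule.Quotient.mk_smul,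
        ← Submodule.Quotient.mk_add] at hi
      obtain ⟨d, hd⟩ := (mem_span_pow_iff _ _).mp ((Submodule.Quotient.eq _).mp hi)
      exact ⟨a i, b i, d, sub_eq_iff_eq_add'.mp hd⟩
    · intro hx
      choose a b d habd using fun i => (hΘker (m i) (x i)).mp (congrFun hx i)
      refine ⟨fun i => Submodule.Quotient.mk (a i), fun i => Submodule.Quotient.mk (b i), funext fun i => ?_⟩
      rw [Pi.add_apply, Pi.smul_apply, Pi.smul_apply, ← Submodule.Quotient.mk_smul, ← Submodule.Quotient.mk_smul,
        ← Submodule.Quotient.mk_add]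
      refine (Submodule.Quotient.eq _).mpr ((mem_span_pow_iff _ _).mpr ⟨d i, ?_⟩)
      rw [sub_eq_iff_eq_add']
      exact habd i
  rw [← AddSubgroup.index_comap_of_surjective S hq, hker, AddSubgroup.index_ker, hΦ]
  have hcard : Nat.card (ZMod (p ^ n) × ZMod (p ^ n)) = p ^ (2 * n) := by
    rw [Nat.card_prod, Nat.card_zmod, ← pow_add, two_mul]
  simp only [AddSubgroup.card_top, Nat.card_pi, Nat.card_zmod, Finset.prod_const, Finset.card_univ,
    ← Nat.card_eq_fintype_card, hcard, ← pow_mul]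
  rw [Finset.sum_mul, ← Finset.prod_pow_eq_pow_sum]

end ElementaryModule

/-! ### Coinvariants as cokernels of `h ^ k - 1` and `γ ^ (p ^ n) - 1` -/

section Coinvariants

variable {p : ℕ} [hp : Fact p.Prime] {G : Type u} [Group G] [TopologicalSpace G]
  [IsTopologicalGroup G] [TotallyDisconnectedSpace G]
  {H Γ : Subgroup G} (eH : H ≃ₜ* Multiplicative ℤ_[p]) (eΓ : Γ ≃ₜ* Multiplicative ℤ_[p])
  {X : Type u} [AddCommGroup X] [Module (IwasawaAlgebra p G) X]

theorem mem_augmentationSubmodule_powSubgroup_iff [CompactSpace G] [H.Normal] (k : ℕ) (y : X) :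
    y ∈ augmentationSubmodule p (powSubgroup H k) X ↔ ∃ x, y = generatorPowSubOne eH k • x := by
  have := isCompact_iff_compactSpace.mp (isClosed_powSubgroup eH k).isCompact
  have : CompactSpace (powSubgroup H k) := this
  exact mem_augmentationSubmodule_iff _ (denseRange_powSubgroup eH k) (exists_mul_generatorPowSubOne_eq eH k) y

/-- The outer coinvariants are formed over `Λ(Γ)`, for powers in `Γ` as a subgroup of itself; here
they become the cokernel of an element of `Λ(G)`. -/
theorem card_doubleCoinvariants (n : ℕ) : Nat.card (DoubleCoinvariants p H Γ n X) =
    (Module.toAddMonoidEnd (IwasawaAlgebra p G) (Coinvariants p (powSubgroup H (p ^ n)) X)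
      (generatorPowSubOne eΓ (p ^ n))).range.index := by
  let := restrictModule p Γ (Coinvariants p (powSubgroup H (p ^ n)) X)
  have := compactSpace_of_padic eΓ
  let eT : (⊤ : Subgroup Γ) ≃ₜ* Multiplicative ℤ_[p] := (topContinuousMulEquiv Γ).trans eΓ
  have : CompactSpace (powSubgroup (⊤ : Subgroup Γ) (p ^ n)) :=
    isCompact_iff_compactSpace.mp (isClosed_powSubgroup eT (p ^ n)).isCompact
  have key : ∀ y : Coinvariants p (powSubgroup H (p ^ n)) X,
      y ∈ augmentationSubmodule p (G := Γ) (powSubgroup (⊤ : Subgroup Γ) (p ^ n)) (Coinvariants p (powSubgroup H (p ^ n)) X) ↔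
        y ∈ (Module.toAddMonoidEnd (IwasawaAlgebra p G) (Coinvariants p (powSubgroup H (p ^ n)) X)
          (generatorPowSubOne eΓ (p ^ n))).range := by
    intro y
    rw [mem_augmentationSubmodule_iff _ (denseRange_powSubgroup eT (p ^ n))
      (fun x => ⟨x, iwasawaAlgebra_mul_comm p (mul_comm_of_padic eΓ) _ _⟩)]
    have h1 : ∀ x : Coinvariants p (powSubgroup H (p ^ n)) X,
        iwasawaInclusion p Γ (iwasawaOf p (((padicGenerator eT : (⊤ : Subgroup Γ)) : Γ) ^ p ^ n) - 1) • x =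
          generatorPowSubOne eΓ (p ^ n) • x := by
      intro x
      rw [map_sub, map_one, iwasawaInclusion_of]
      rfl
    constructor
    · rintro ⟨x, rfl⟩; exact ⟨x, (h1 x).symm⟩
    · rintro ⟨x, rfl⟩; exact ⟨x, (h1 x).symm⟩
  have h2 : (augmentationSubmodule p (G := Γ) (powSubgroup (⊤ : Subgroup Γ) (p ^ n))
      (Coinvariants p (powSubgroup H (p ^ n)) X)).toAddSubgroup = (Module.toAddMonoidEnd (IwasawaAlgebra p G)
        (Coinvariants p (powSubgroup H (p ^ n)) X) (generatorPowSubOne eΓ (p ^ n))).range :=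
    AddSubgroup.ext key
  rw [← h2]
  rfl

end Coinvariants

/-! ### Finite stable subsets, invariance of pseudo-nullity, and the constants of a module -/

section Orbits

variable {p : ℕ} [hp : Fact p.Prime] {G : Type u} [Group G] [TopologicalSpace G]
  {X : Type u} [AddCommGroup X] [Module (IwasawaAlgebra p G) X]

/-- Pigeonhole on the orbit of `y`, followed by cancellation of the invertible `g ^ a`. -/
theorem iwasawaOf_smul_eq_self_of_finite (N : Set X) (hN : N.Finite) (g : G)
    (hg : ∀ y ∈ N, iwasawaOf p g • y ∈ N) {y : X} (hy : y ∈ N) :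
    ∃ j : ℕ, j ≠ 0 ∧ (iwasawaOf p (g ^ j) - 1) • y = 0 := by
  have hmem : ∀ k : ℕ, iwasawaOf p (g ^ k) • y ∈ N := by
    intro k
    induction k with
    | zero => rwa [pow_zero, map_one, one_smul]
    | succ k ih => rw [pow_succ', map_mul, mul_smul]; exact hg _ ih
  obtain ⟨a, b, hab, h⟩ : ∃ a b : ℕ, a < b ∧ iwasawaOf p (g ^ a) • y = iwasawaOf p (g ^ b) • y := by
    obtain ⟨a, -, b, -, hab, h⟩ := Set.infinite_univ.exists_lt_map_eq_of_mapsTo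
      (f := fun k : ℕ => iwasawaOf p (g ^ k) • y) (fun k _ => hmem k) hN
    exact ⟨a, b, hab, h⟩
  refine ⟨b - a, by omega, ?_⟩
  have h1 : iwasawaOf p (g ^ a) • (iwasawaOf p (g ^ (b - a)) • y - y) = 0 := by
    rw [smul_sub, ← mul_smul, ← map_mul, ← pow_add, Nat.add_sub_cancel' hab.le, h, sub_self]
  have h2 := congrArg (fun z => iwasawaOf p (g ^ a)⁻¹ • z) h1
  simp only [← mul_smul, ← map_mul, inv_mul_cancel, map_one, one_smul, smul_zero] at h2
  rw [sub_smul, one_smul, h2]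

end Orbits

section PseudoNull

variable {Λ : Type u} [Ring Λ] {M N : Type u} [AddCommGroup M] [Module Λ M] [AddCommGroup N] [Module Λ N]

theorem IsPseudoNull.of_linearEquiv (e : M ≃ₗ[Λ] N) (h : IsPseudoNull Λ M) : IsPseudoNull Λ N := by
  intro i hi
  have := h i hi
  let iso := ((Abelian.extFunctor (C := ModuleCat Λ) i).mapIso e.toModuleIso.op).app (ModuleCat.of Λ Λ)
  exact @Equiv.subsingleton _ _ iso.addCommGroupIsoToAddEquiv.toEquiv this

end PseudoNull

section Asymptotics

variable {p : ℕ} [hp : Fact p.Prime] {G : Type u} [Group G] [TopologicalSpace G]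
  {H Γ : Subgroup G} (eH : H ≃ₜ* Multiplicative ℤ_[p]) (eΓ : Γ ≃ₜ* Multiplicative ℤ_[p])

/-- The numbers `μ` and `ν` describe the orders of the coinvariants and invariants of `M`
under the subgroups `H ^ (p ^ n)`. -/
structure HasAsymptotics (M : Type u) [AddCommGroup M] [Module (IwasawaAlgebra p G) M] (μ ν : ℕ) : Prop where
  hasHerbrandExponent : ∀ n, HasHerbrandExponent p
    (Module.toAddMonoidEnd (IwasawaAlgebra p G) M (generatorPowSubOne eH (p ^ n))) (μ * p ^ n)
  card_ker_le : ∀ n,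
    Nat.card (Module.toAddMonoidEnd (IwasawaAlgebra p G) M (generatorPowSubOne eH (p ^ n))).ker ≤ p ^ ν
  card_ker_eq : ∀ᶠ n in Filter.atTop,
    Nat.card (Module.toAddMonoidEnd (IwasawaAlgebra p G) M (generatorPowSubOne eH (p ^ n))).ker = p ^ ν

theorem exists_hasAsymptotics [IsTopologicalGroup G] (M : Type u) [AddCommGroup M] [Module (IwasawaAlgebra p G) M]
    (hfg : IsFinitelyGeneratedOver p H M) (hM : ∀ x : M, ∃ k : ℕ, p ^ k • x = 0) :
    ∃ μ ν, HasAsymptotics eH M μ ν := by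
  let := restrictModule p H M
  obtain ⟨μ, ν, h1, h2, h3⟩ := @IsParameterMod.exists_card_asymptotics _
    (iwasawaCommRing p (mul_comm_of_padic eH)) p _ M _ (restrictModule p H M)
    (isParameterMod_iwasawaOf_sub_one p eH) hp hfg hM
  -- With `T = h - 1`, the operator `(1 + T) ^ p ^ n - 1` over `Λ(H)` is `h ^ (p ^ n) - 1` over
  -- `Λ(G)`.
  have key : ∀ n, Module.toAddMonoidEnd (IwasawaAlgebra p H) M
      ((1 + (iwasawaOf p (padicGenerator eH) - 1)) ^ p ^ n - 1) =
      Module.toAddMonoidEnd (IwasawaAlgebra p G) M (generatorPowSubOne eH (p ^ n)) := by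
    intro n
    ext x
    change iwasawaInclusion p H ((1 + (iwasawaOf p (padicGenerator eH) - 1)) ^ p ^ n - 1) • x =
      generatorPowSubOne eH (p ^ n) • x
    rw [add_sub_cancel, map_sub, map_one, map_pow, iwasawaInclusion_of, generatorPowSubOne, map_pow]
  refine ⟨μ, ν, fun n => ?_, fun n => ?_, ?_⟩
  · rw [← key]; exact h1 n
  · rw [← key]; exact h2 n
  · filter_upwards [h3] with n hn
    rw [← key]; exact hn

end Asymptotics

section Quotient

variable {R E : Type*} [Ring R] [AddCommGroup E] [Module R E] {S : Submodule R E} {g h : R}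

theorem mem_comap_mkQ_range_toAddMonoidEnd_iff (hS : ∀ y, y ∈ S ↔ ∃ a, y = h • a) {e : E} :
    e ∈ ((Module.toAddMonoidEnd R (E ⧸ S) g).range.comap S.mkQ.toAddMonoidHom) ↔
      ∃ a b, e = h • a + g • b := by
  constructor
  · rintro ⟨y, hy⟩
    obtain ⟨b, rfl⟩ := Submodule.Quotient.mk_surjective _ y
    have hy : (Submodule.Quotient.mk (g • b) : E ⧸ S) = Submodule.Quotient.mk e := hy
    rw [eq_comm, Submodule.Quotient.eq, hS] at hy
    obtain ⟨a, ha⟩ := hy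
    exact ⟨a, b, sub_eq_iff_eq_add.mp ha⟩
  · rintro ⟨a, b, rfl⟩
    refine ⟨Submodule.Quotient.mk b, ?_⟩
    change (Submodule.Quotient.mk (g • b) : E ⧸ S) = Submodule.Quotient.mk _
    rw [eq_comm, Submodule.Quotient.eq, hS]
    exact ⟨a, add_sub_cancel_right _ _⟩

theorem index_comap_mkQ_range_toAddMonoidEnd (S : Submodule R E) (g : R) :
    ((Module.toAddMonoidEnd R (E ⧸ S) g).range.comap S.mkQ.toAddMonoidHom).index =
      (Module.toAddMonoidEnd R (E ⧸ S) g).range.index :=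
  AddSubgroup.index_comap_of_surjective _ (Submodule.Quotient.mk_surjective S)

end Quotient

/-! ### The `μ_G`-invariant and maps on coinvariants -/

section MuInvariant

variable {p : ℕ} [Fact p.Prime] {G : Type u} [Group G] [TopologicalSpace G] {H : Subgroup G}
  {A X Y B : Type u} [AddCommGroup A] [AddCommGroup X] [AddCommGroup Y] [AddCommGroup B]
  [Module (IwasawaAlgebra p G) A] [Module (IwasawaAlgebra p G) X] [Module (IwasawaAlgebra p G) Y]
  [Module (IwasawaAlgebra p G) B]

/-- As `X(p) = X`, the given map itself serves as the pseudo-isomorphism: its kernel is isomorphic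
to `A` and its cokernel to `B`. -/
theorem isMuInvariant_of_exact {s : ℕ} {m : Fin s → ℕ}
    {ι : A →ₗ[IwasawaAlgebra p G] X} {φ : X →ₗ[IwasawaAlgebra p G] ElementaryModule p G m}
    {π : ElementaryModule p G m →ₗ[IwasawaAlgebra p G] B} (hX : pTorsion p G X = ⊤)
    (hι : Function.Injective ι) (hιφ : Function.Exact ι φ)
    (hφπ : Function.Exact φ π) (hπ : Function.Surjective π)
    (hA : IsPseudoNull (IwasawaAlgebra p G) A) (hB : IsPseudoNull (IwasawaAlgebra p G) B) :
    IsMuInvariant p G X (∑ i, m i) := by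
  have hmem : ∀ x : X, x ∈ pTorsion p G X := fun x => hX ▸ Submodule.mem_top
  let ψ : pTorsion p G X →ₗ[IwasawaAlgebra p G] ElementaryModule p G m := φ.comp (pTorsion p G X).subtype
  refine ⟨s, m, ψ, hA.of_linearEquiv ?_, hB.of_linearEquiv ?_, rfl⟩
  · refine LinearEquiv.ofBijective
      (LinearMap.codRestrict (LinearMap.ker ψ) (LinearMap.codRestrict (pTorsion p G X) ι fun a => hmem _)
        fun a => (hιφ (ι a)).mpr ⟨a, rfl⟩) ⟨fun a b h => ?_, fun y => ?_⟩
    · exact hι (congrArg (fun z : LinearMap.ker ψ => ((z : pTorsion p G X) : X)) h)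
    · obtain ⟨a, ha⟩ := (hιφ ((y : pTorsion p G X) : X)).mp y.2
      exact ⟨a, Subtype.ext (Subtype.ext ha)⟩
  · have h : LinearMap.range ψ = LinearMap.ker π := by
      ext e
      rw [LinearMap.mem_ker, hφπ e]
      constructor
      · rintro ⟨x, rfl⟩; exact ⟨x, rfl⟩
      · rintro ⟨x, rfl⟩; exact ⟨⟨x, hmem x⟩, rfl⟩
    exact ((Submodule.quotEquivOfEq _ _ h).trans (π.quotKerEquivOfSurjective hπ)).symm

/-- The map induced on coinvariants by a homomorphism. -/
def coinvariantsMap [H.Normal] (k : ℕ) (φ : X →ₗ[IwasawaAlgebra p G] Y) :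
    Coinvariants p (powSubgroup H k) X →ₗ[IwasawaAlgebra p G] Coinvariants p (powSubgroup H k) Y :=
  Submodule.mapQ _ _ φ (by
    rw [augmentationSubmodule, Submodule.span_le]
    rintro _ ⟨a, ha, x, rfl⟩
    rw [SetLike.mem_coe, Submodule.mem_comap, map_smul]
    exact Submodule.subset_span ⟨a, ha, φ x, rfl⟩)

theorem coinvariantsMap_mk [H.Normal] (k : ℕ) (φ : X →ₗ[IwasawaAlgebra p G] Y) (x : X) :
    coinvariantsMap (H := H) k φ (Submodule.Quotient.mk x) = Submodule.Quotient.mk (φ x) := rfl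

end MuInvariant

/-! ### Coinvariants of the four-term exact sequence -/

section Sequence

variable {p : ℕ} [hp : Fact p.Prime] {G : Type u} [Group G] [TopologicalSpace G]
  [IsTopologicalGroup G] [CompactSpace G] [TotallyDisconnectedSpace G]
  {H Γ : Subgroup G} (eH : H ≃ₜ* Multiplicative ℤ_[p]) (eΓ : Γ ≃ₜ* Multiplicative ℤ_[p])
  {A X Y B : Type u} [AddCommGroup A] [AddCommGroup X] [AddCommGroup Y] [AddCommGroup B]
  [Module (IwasawaAlgebra p G) A] [Module (IwasawaAlgebra p G) X] [Module (IwasawaAlgebra p G) Y]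
  [Module (IwasawaAlgebra p G) B]

-- The kernel of `X_{H_n} → E_{H_n}` has order `#A_{H_n} · #B^{H_n}`, by
-- `relIndex_range_comap_range` for the operator `h ^ (p ^ n) - 1`, which is injective on `E`.
include eH in
theorem card_ker_coinvariantsMap [H.Normal] (n : ℕ) {s : ℕ} {m : Fin s → ℕ}
    {ι : A →ₗ[IwasawaAlgebra p G] X} {φ : X →ₗ[IwasawaAlgebra p G] ElementaryModule p G m}
    {π : ElementaryModule p G m →ₗ[IwasawaAlgebra p G] B} (hι : Function.Injective ι) (hιφ : Function.Exact ι φ)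
    (hφπ : Function.Exact φ π) (hπ : Function.Surjective π) :
    Nat.card (LinearMap.ker (coinvariantsMap (H := H) (p ^ n) φ)) =
      (Module.toAddMonoidEnd (IwasawaAlgebra p G) A (generatorPowSubOne eH (p ^ n))).range.index *
        Nat.card (Module.toAddMonoidEnd (IwasawaAlgebra p G) B (generatorPowSubOne eH (p ^ n))).ker := by
  rw [← relIndex_range_comap_range (τA := Module.toAddMonoidEnd (IwasawaAlgebra p G) A (generatorPowSubOne eH (p ^ n)))
    (τX := Module.toAddMonoidEnd (IwasawaAlgebra p G) X (generatorPowSubOne eH (p ^ n)))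
    (τE := Module.toAddMonoidEnd (IwasawaAlgebra p G) (ElementaryModule p G m) (generatorPowSubOne eH (p ^ n)))
    (τB := Module.toAddMonoidEnd (IwasawaAlgebra p G) B (generatorPowSubOne eH (p ^ n)))
    (i := ι.toAddMonoidHom) (φ := φ.toAddMonoidHom) (q := π.toAddMonoidHom) hι ?_ ?_ hπ
    (fun x => (map_smul ι _ x).symm) (fun x => (map_smul φ _ x).symm) (fun x => (map_smul π _ x).symm) ?_]
  · let q : X →+ Coinvariants p (powSubgroup H (p ^ n)) X :=
      (augmentationSubmodule p (powSubgroup H (p ^ n)) X).mkQ.toAddMonoidHom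
    have h1 : (Module.toAddMonoidEnd (IwasawaAlgebra p G) X (generatorPowSubOne eH (p ^ n))).range = q.ker := by
      ext y
      refine Iff.trans ?_ (Submodule.Quotient.mk_eq_zero _).symm
      rw [mem_augmentationSubmodule_powSubgroup_iff eH]
      exact ⟨fun ⟨x, hx⟩ => ⟨x, hx.symm⟩, fun ⟨x, hx⟩ => ⟨x, hx.symm⟩⟩
    rw [h1, AddSubgroup.relIndex_ker]
    have h2 : (((Module.toAddMonoidEnd (IwasawaAlgebra p G) (ElementaryModule p G m)
        (generatorPowSubOne eH (p ^ n))).range.comap φ.toAddMonoidHom).map q) =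
        (LinearMap.ker (coinvariantsMap (H := H) (p ^ n) φ)).toAddSubgroup := by
      have h3 : ∀ x : X, φ x ∈ augmentationSubmodule p (powSubgroup H (p ^ n)) (ElementaryModule p G m) ↔
          φ x ∈ (Module.toAddMonoidEnd (IwasawaAlgebra p G) (ElementaryModule p G m)
            (generatorPowSubOne eH (p ^ n))).range := by
        intro x
        rw [mem_augmentationSubmodule_powSubgroup_iff eH]
        exact ⟨fun ⟨x, hx⟩ => ⟨x, hx.symm⟩, fun ⟨x, hx⟩ => ⟨x, hx.symm⟩⟩
      ext y
      obtain ⟨x, rfl⟩ := Submodule.Quotient.mk_surjective _ y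
      rw [Submodule.mem_toAddSubgroup, LinearMap.mem_ker, coinvariantsMap_mk, Submodule.Quotient.mk_eq_zero]
      constructor
      · rintro ⟨z, hz, hzx⟩
        have h4 : coinvariantsMap (H := H) (p ^ n) φ (Submodule.Quotient.mk z) = 0 := by
          rw [coinvariantsMap_mk, Submodule.Quotient.mk_eq_zero]
          exact (h3 z).mpr hz
        have h5 : (Submodule.Quotient.mk z : Coinvariants p (powSubgroup H (p ^ n)) X) = Submodule.Quotient.mk x := hzx
        rwa [h5, coinvariantsMap_mk, Submodule.Quotient.mk_eq_zero] at h4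
      · intro hx
        exact ⟨x, (h3 x).mp hx, rfl⟩
    rw [h2]
    rfl
  · ext y
    exact (hιφ y).symm
  · ext y
    exact (hφπ y).symm
  · exact (injective_iff_map_eq_zero _).mpr fun e he => eq_zero_of_generatorPowSubOne_smul_eq_zero eH n he

include eH in
theorem eq_zero_of_generatorPowSubOne_smul_coinvariants [H.Normal] (hHΓ : H.IsComplement' Γ) (n : ℕ) {j : ℕ}
    (hj : j ≠ 0) {s : ℕ} {m : Fin s → ℕ} {e : Coinvariants p (powSubgroup H (p ^ n)) (ElementaryModule p G m)}
    (h : generatorPowSubOne eΓ j • e = 0) : e = 0 := by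
  obtain ⟨e, rfl⟩ := Submodule.Quotient.mk_surjective _ e
  rw [← Submodule.Quotient.mk_smul, Submodule.Quotient.mk_eq_zero,
    mem_augmentationSubmodule_powSubgroup_iff eH] at h
  obtain ⟨z, hz⟩ := h
  rw [Submodule.Quotient.mk_eq_zero, mem_augmentationSubmodule_powSubgroup_iff eH]
  exact exists_eq_smul_of_generatorPowSubOne_smul eH eΓ hHΓ n hj hz

-- The finite kernel belongs to the family of finite submodules. Conversely, an element of a finite
-- submodule is fixed by some `γ ^ j` with `j ≠ 0`, and so is its image in `E_{H_n}`, which must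
-- then be `0`.
include eH eΓ in
theorem card_finitePartOfCoinvariants [H.Normal] (hHΓ : H.IsComplement' Γ) (n : ℕ) {s : ℕ} {m : Fin s → ℕ}
    (φ : X →ₗ[IwasawaAlgebra p G] ElementaryModule p G m)
    (hfin : Finite (LinearMap.ker (coinvariantsMap (H := H) (p ^ n) φ))) :
    Nat.card (FinitePartOfCoinvariants p H Γ n X) =
      Nat.card (LinearMap.ker (coinvariantsMap (H := H) (p ^ n) φ)) := by
  let := restrictModule p Γ (Coinvariants p (powSubgroup H (p ^ n)) X)
  let K : Submodule (IwasawaAlgebra p Γ) (Coinvariants p (powSubgroup H (p ^ n)) X) :=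
    { (LinearMap.ker (coinvariantsMap (H := H) (p ^ n) φ)).toAddSubgroup with
      smul_mem' := fun a x hx =>
        (LinearMap.ker (coinvariantsMap (H := H) (p ^ n) φ)).smul_mem (iwasawaInclusion p Γ a) hx }
  have hK : maximalFiniteSubmodule (IwasawaAlgebra p Γ) (Coinvariants p (powSubgroup H (p ^ n)) X) = K := by
    refine le_antisymm (sSup_le fun N hN y hy => ?_) (le_sSup hfin)
    obtain ⟨j, hj, hj0⟩ := iwasawaOf_smul_eq_self_of_finite (p := p)
      (N : Set (Coinvariants p (powSubgroup H (p ^ n)) X)) (Set.finite_coe_iff.mp hN) ((padicGenerator eΓ : Γ) : G)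
      (fun z (hz : z ∈ N) => by
        have h1 := N.smul_mem (iwasawaOf p (padicGenerator eΓ)) hz
        change iwasawaInclusion p Γ _ • z ∈ N at h1
        rwa [iwasawaInclusion_of] at h1) hy
    have h2 := congrArg (coinvariantsMap (H := H) (p ^ n) φ) hj0
    rw [map_smul, map_zero] at h2
    exact eq_zero_of_generatorPowSubOne_smul_coinvariants eH eΓ hHΓ n hj h2
  change Nat.card (maximalFiniteSubmodule (IwasawaAlgebra p Γ) (Coinvariants p (powSubgroup H (p ^ n)) X)) = _
  rw [hK]
  rfl

-- `exists_index_range_eq_mul` for `γ ^ (p ^ n) - 1` on `X_{H_n} → E_{H_n} → B_{H_n} → 0`. The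
-- factor `c` is the order of the cokernel on the kernel of the first map.
include eH eΓ in
theorem exists_card_doubleCoinvariants_eq [H.Normal] (hHΓ : H.IsComplement' Γ) (n : ℕ) {s : ℕ} {m : Fin s → ℕ}
    {φ : X →ₗ[IwasawaAlgebra p G] ElementaryModule p G m}
    {π : ElementaryModule p G m →ₗ[IwasawaAlgebra p G] B}
    (hφπ : Function.Exact φ π) (hπ : Function.Surjective π)
    (hfin : Finite (LinearMap.ker (coinvariantsMap (H := H) (p ^ n) φ)))
    (hB : (Module.toAddMonoidEnd (IwasawaAlgebra p G) B (generatorPowSubOne eH (p ^ n))).range.index ≠ 0) :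
    ∃ c, 0 < c ∧ c ≤ Nat.card (LinearMap.ker (coinvariantsMap (H := H) (p ^ n) φ)) ∧
      Nat.card (DoubleCoinvariants p H Γ n X) = p ^ ((∑ i, m i) * p ^ (2 * n)) * c := by
  have hBfin : Finite (Coinvariants p (powSubgroup H (p ^ n)) B) := by
    have h1 : (Module.toAddMonoidEnd (IwasawaAlgebra p G) B (generatorPowSubOne eH (p ^ n))).range =
        (augmentationSubmodule p (powSubgroup H (p ^ n)) B).toAddSubgroup := by
      ext y
      rw [Submodule.mem_toAddSubgroup, mem_augmentationSubmodule_powSubgroup_iff eH]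
      exact ⟨fun ⟨x, hx⟩ => ⟨x, hx.symm⟩, fun ⟨x, hx⟩ => ⟨x, hx.symm⟩⟩
    rw [h1] at hB
    exact Nat.finite_of_card_ne_zero hB
  have hfin' : Finite (coinvariantsMap (H := H) (p ^ n) φ).toAddMonoidHom.ker := hfin
  obtain ⟨c, hc0, hc, h⟩ := exists_index_range_eq_mul
    (σX := Module.toAddMonoidEnd (IwasawaAlgebra p G) (Coinvariants p (powSubgroup H (p ^ n)) X)
      (generatorPowSubOne eΓ (p ^ n)))
    (σE := Module.toAddMonoidEnd (IwasawaAlgebra p G) (Coinvariants p (powSubgroup H (p ^ n)) (ElementaryModule p G m))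
      (generatorPowSubOne eΓ (p ^ n)))
    (σB := Module.toAddMonoidEnd (IwasawaAlgebra p G) (Coinvariants p (powSubgroup H (p ^ n)) B)
      (generatorPowSubOne eΓ (p ^ n)))
    (φ := (coinvariantsMap (H := H) (p ^ n) φ).toAddMonoidHom) (q := (coinvariantsMap (H := H) (p ^ n) π).toAddMonoidHom)
    (by
      ext y
      obtain ⟨e, rfl⟩ := Submodule.Quotient.mk_surjective _ y
      constructor
      · rintro ⟨x, hx⟩
        obtain ⟨x, rfl⟩ := Submodule.Quotient.mk_surjective _ x
        have hx : coinvariantsMap (H := H) (p ^ n) φ (Submodule.Quotient.mk x) = Submodule.Quotient.mk e := hx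
        change coinvariantsMap (H := H) (p ^ n) π (Submodule.Quotient.mk e) = 0
        rw [← hx, coinvariantsMap_mk, coinvariantsMap_mk, (hφπ (φ x)).mpr ⟨x, rfl⟩, Submodule.Quotient.mk_zero]
      · intro he
        have he : coinvariantsMap (H := H) (p ^ n) π (Submodule.Quotient.mk e) = 0 := he
        rw [coinvariantsMap_mk, Submodule.Quotient.mk_eq_zero, mem_augmentationSubmodule_powSubgroup_iff eH] at he
        -- Right exactness of coinvariants: lift `b` to `E` and correct `e` by a multiple of `h ^ (p
        -- ^ n) - 1`, so that it maps to `0` in `B`.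
        obtain ⟨b, hb⟩ := he
        obtain ⟨e', rfl⟩ := hπ b
        obtain ⟨x, hx⟩ := (hφπ (e - generatorPowSubOne eH (p ^ n) • e')).mp (by rw [map_sub, map_smul, hb, sub_self])
        refine ⟨Submodule.Quotient.mk x, ?_⟩
        change coinvariantsMap (H := H) (p ^ n) φ (Submodule.Quotient.mk x) = _
        rw [coinvariantsMap_mk, hx, Submodule.Quotient.eq, mem_augmentationSubmodule_powSubgroup_iff eH]
        exact ⟨-e', by rw [smul_neg]; abel⟩)
    (fun y => by
      obtain ⟨b, rfl⟩ := Submodule.Quotient.mk_surjective _ y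
      obtain ⟨e, rfl⟩ := hπ b
      exact ⟨Submodule.Quotient.mk e, rfl⟩)
    (fun x => (map_smul (coinvariantsMap (H := H) (p ^ n) φ) _ x).symm)
    (fun x => (map_smul (coinvariantsMap (H := H) (p ^ n) π) _ x).symm)
    ((injective_iff_map_eq_zero _).mpr fun e he =>
      eq_zero_of_generatorPowSubOne_smul_coinvariants eH eΓ hHΓ n (pow_ne_zero _ hp.out.ne_zero) he)
  refine ⟨c, hc0, hc, ?_⟩
  rw [card_doubleCoinvariants eΓ, h]
  congr 1
  rw [← index_comap_mkQ_range_toAddMonoidEnd]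
  exact index_elementaryModule eH eΓ hHΓ n _ fun e =>
    mem_comap_mkQ_range_toAddMonoidEnd_iff (mem_augmentationSubmodule_powSubgroup_iff eH (p ^ n))

end Sequence

end

/-! ### The theorem -/

theorem corollary3p2 (p : ℕ) [Fact p.Prime]
    (G : Type u) [Group G] [TopologicalSpace G] [IsTopologicalGroup G] [CompactSpace G]
    [TotallyDisconnectedSpace G]
    (H Γ : Subgroup G) [H.Normal] (hHΓ : H.IsComplement' Γ)
    (hH : Nonempty (H ≃ₜ* Multiplicative ℤ_[p])) (hΓ : Nonempty (Γ ≃ₜ* Multiplicative ℤ_[p])) :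
    -- the constants `μ_A`, `ν_A` and `ν_B`, as functions of the modules `A` and `B`
    ∃ μ ν ν' : (M : Type u) → [AddCommGroup M] → [Module (IwasawaAlgebra p G) M] → ℕ,
    ∀ (X A B : Type u) [AddCommGroup X] [AddCommGroup A] [AddCommGroup B]
      [Module (IwasawaAlgebra p G) X] [Module (IwasawaAlgebra p G) A]
      [Module (IwasawaAlgebra p G) B]
      (s : ℕ) (m : Fin s → ℕ)
      (ι : A →ₗ[IwasawaAlgebra p G] X)
      (φ : X →ₗ[IwasawaAlgebra p G] ElementaryModule p G m)
      (π : ElementaryModule p G m →ₗ[IwasawaAlgebra p G] B),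
      Module.Finite (IwasawaAlgebra p G) X → pTorsion p G X = ⊤ →
      Function.Injective ι → Function.Exact ι φ → Function.Exact φ π → Function.Surjective π →
      IsPseudoNull (IwasawaAlgebra p G) A → IsPseudoNull (IwasawaAlgebra p G) B →
      IsFinitelyGeneratedOver p H A → IsFinitelyGeneratedOver p H B →
      IsMuInvariant p G X (∑ i, m i) ∧
      (∀ᶠ k : ℕ in Filter.atTop,
        Nat.card (FinitePartOfCoinvariants p H Γ k X) = p ^ (μ A * p ^ k + ν A + ν' B)) ∧
      ∀ n : ℕ,
        p ^ ((∑ i, m i) * p ^ (2 * n)) ≤ Nat.card (DoubleCoinvariants p H Γ n X) ∧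
        Nat.card (DoubleCoinvariants p H Γ n X) ≤
          p ^ ((∑ i, m i) * p ^ (2 * n) + μ A * p ^ n + ν A + ν' B) := by
  classical
  obtain ⟨eH⟩ := hH
  obtain ⟨eΓ⟩ := hΓ
  -- The constants are chosen for each module from its asymptotics alone, before any sequence is
  -- given; `0` is the default for modules without asymptotics. The same `ν`, the exponent of the
  -- stable invariants, serves for `A` and for `B`.
  let μ (M : Type u) [AddCommGroup M] [Module (IwasawaAlgebra p G) M] : ℕ :=
    if h : ∃ μ ν, HasAsymptotics eH M μ ν then h.choose else 0
  let ν (M : Type u) [AddCommGroup M] [Module (IwasawaAlgebra p G) M] : ℕ :=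
    if h : ∃ μ ν, HasAsymptotics eH M μ ν then h.choose_spec.choose else 0
  have hμν : ∀ (M : Type u) [AddCommGroup M] [Module (IwasawaAlgebra p G) M],
      (∃ μ ν, HasAsymptotics eH M μ ν) → HasAsymptotics eH M (μ M) (ν M) := by
    intro M _ _ h
    simp only [μ, ν, dif_pos h]
    exact h.choose_spec.choose_spec
  refine ⟨μ, ν, ν, ?_⟩
  intro X A B _ _ _ _ _ _ s m ι φ π _ hX hι hιφ hφπ hπ hA hB hAfg hBfg
  -- `A` is `p`-power torsion because it embeds in `X`, and `B` because it is a quotient of the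
  -- elementary module, which is killed by `p ^ ∑ i, m i`.
  have hAsymp := hμν A (exists_hasAsymptotics eH A hAfg fun a => by
    obtain ⟨k, hk⟩ : ι a ∈ pTorsion p G X := hX ▸ Submodule.mem_top
    exact ⟨k, hι (by rw [map_nsmul, hk, map_zero])⟩)
  have hBsymp := hμν B (exists_hasAsymptotics eH B hBfg fun b => by
    obtain ⟨e, rfl⟩ := hπ b
    exact ⟨∑ i, m i, by rw [← map_nsmul, exists_pow_smul_elementaryModule_eq_zero, map_zero]⟩)
  have hcard : ∀ n, Nat.card (LinearMap.ker (coinvariantsMap (H := H) (p ^ n) φ)) =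
      p ^ (μ A * p ^ n) *
        Nat.card (Module.toAddMonoidEnd (IwasawaAlgebra p G) A (generatorPowSubOne eH (p ^ n))).ker *
        Nat.card (Module.toAddMonoidEnd (IwasawaAlgebra p G) B (generatorPowSubOne eH (p ^ n))).ker := by
    intro n
    rw [card_ker_coinvariantsMap eH n hι hιφ hφπ hπ, (hAsymp.hasHerbrandExponent n).index_range_eq]
  have hfin : ∀ n, Finite (LinearMap.ker (coinvariantsMap (H := H) (p ^ n) φ)) := by
    intro n
    refine Nat.finite_of_card_ne_zero ?_
    rw [card_ker_coinvariantsMap eH n hι hιφ hφπ hπ]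
    exact mul_ne_zero (hAsymp.hasHerbrandExponent n).index_range_ne_zero
      (hBsymp.hasHerbrandExponent n).card_ker_ne_zero
  refine ⟨isMuInvariant_of_exact hX hι hιφ hφπ hπ hA hB, ?_, fun n => ?_⟩
  · filter_upwards [hAsymp.card_ker_eq, hBsymp.card_ker_eq] with k hk hk'
    rw [card_finitePartOfCoinvariants eH eΓ hHΓ k φ (hfin k), hcard, hk, hk', ← pow_add, ← pow_add]
  · obtain ⟨c, hc0, hc, h⟩ := exists_card_doubleCoinvariants_eq eH eΓ hHΓ n hφπ hπ (hfin n)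
      (hBsymp.hasHerbrandExponent n).index_range_ne_zero
    rw [h]
    -- The lower bound is `c ≥ 1`. The upper bound is `c ≤ #K`, where the orders of the invariants
    -- of `A` and `B` are at most their stable values for every `n`.
    refine ⟨Nat.le_mul_of_pos_right _ hc0, ?_⟩
    rw [add_assoc, add_assoc, pow_add _ ((∑ i, m i) * p ^ (2 * n))]
    refine Nat.mul_le_mul_left _ (hc.trans ?_)
    rw [hcard, pow_add, pow_add, ← mul_assoc]
    exact Nat.mul_le_mul (Nat.mul_le_mul_left _ (hAsymp.card_ker_le n)) (hBsymp.card_ker_le n)
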